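/- Let $\Bbbk$ be a field of characteristic zero. All nonsymmetric collections and operads are over $\Bbbk$ and have no component of arity $0$. Let $\mathrm{As}$ be the nonsymmetric operad generated by one binary operation $\mu$ with the relation $\mu(\mu(a_1,a_2),a_3)=\mu(a_1,\mu(a_2,a_3))$, and let $\mathrm{Dend}$ be the nonsymmetric operad generated by two binary operations $\prec,\succ$ with the relations $$(a_1\prec a_2)\prec a_3=a_1\prec(a_2\prec a_3)+a_1\prec(a_2\succ a_3),$$ $$(a_1\succ a_2)\prec a_3=a_1\succ(a_2\prec a_3),$$ $$(a_1\prec a_2)\succ a_3+(a_1\succ a_2)\succ a_3=a_1\succ(a_2\succ a_3).$$ (1) There is a unique morphism of nonsymmetric operads $\varphi\colon\mathrm{As}\to\mathrm{Dend}$ with $\varphi(\mu)=\star$, where $\star={\prec}+{\succ}$, and $\mathrm{Dend}$ is a free left $\mathrm{As}$-module via $\varphi$: there are a nonsymmetric collection $\mathcal K$ and a morphism of collections $\iota\colon\mathcal K\to\mathrm{Dend}$ such that the induced morphism of left $\mathrm{As}$-modules $$\mathrm{As}\circ\mathcal K\to\mathrm{Dend},\qquad p\otimes x_1\otimes\cdots\otimes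 x_k\mapsto \varphi(p)(\iota x_1,\ldots,\iota x_k),$$ is an isomorphism. Here $(\mathrm{As}\circ\mathcal K)(r)=\bigoplus_{k}\bigoplus_{n_1+\cdots+n_k=r,\ n_i\ge 1}\mathrm{As}(k)\otimes\mathcal K(n_1)\otimes\cdots\otimes\mathcal K(n_k)$. (2) Consequently (Loday--Ronco), every free dendriform $\Bbbk$-algebra $D$ on an arbitrary set of generators, equipped with the product $a\star b=a\prec b+a\succ b$, is a free associative (non-unital) $\Bbbk$-algebra on some set of generators. -/

import Mathlib

open scoped TensorProduct DirectSum

universe u v w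

/-! ### Nonsymmetric collections, operads and left modules -/

/-- A nonsymmetric collection over `𝕜`. A functor from nonempty finite ordered sets and order
preserving bijections to vector spaces is a family of vector spaces indexed by the positive
integers; we index by `ℕ` and require the component of arity zero to vanish. -/
structure NSCollection (𝕜 : Type u) [Field 𝕜] where
  obj : ℕ → Type v
  [addCommGroup : ∀ n, AddCommGroup (obj n)]
  [module : ∀ n, Module 𝕜 (obj n)]
  subsingleton_zero : Subsingleton (obj 0)

attribute [instance] NSCollection.addCommGroup NSCollection.module

/-- A morphism of nonsymmetric collections. -/
structure NSCollection.Hom {𝕜 : Type u} [Field 𝕜] (K : NSCollection.{u, v} 𝕜)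
    (M : NSCollection.{u, w} 𝕜) where
  toFun : ∀ n, K.obj n →ₗ[𝕜] M.obj n

/-- Reading a doubly indexed family in lexicographic order does not change its sum. -/
theorem sum_lex {k : ℕ} (l : Fin k → ℕ) (n : ∀ i, Fin (l i) → ℕ) (m : Fin k → ℕ)
    (hm : ∀ i, ∑ j, n i j = m i) {r : ℕ} (hr : ∑ i, m i = r) :
    ∑ s : Fin (∑ i, l i), n (finSigmaFinEquiv.symm s).1 (finSigmaFinEquiv.symm s).2 = r := by
  rw [← hr, Fintype.sum_equiv finSigmaFinEquiv.symm
    (fun s => n (finSigmaFinEquiv.symm s).1 (finSigmaFinEquiv.symm s).2)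
    (fun x : (i : Fin k) × Fin (l i) => n x.1 x.2) (fun _ => rfl), Fintype.sum_sigma]
  exact Finset.sum_congr rfl fun i _ => hm i

/-- A nonsymmetric operad: a collection with a unit in arity one and composition maps
`comp : P(k) ⊗ P(n₁) ⊗ … ⊗ P(n_k) → P(n₁ + … + n_k)` (the `i`-th argument is inserted in the `i`-th
input, inputs being read from left to right), which are unital and associative. In `comp_assoc` the
pairs `(i, j)` are read in lexicographic order, through
`finSigmaFinEquiv : (Σ i : Fin k, Fin (l i)) ≃ Fin (∑ i, l i)`. -/
structure NSOperad (𝕜 : Type u) [Field 𝕜] extends NSCollection.{u, v} 𝕜 where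
  one : obj 1
  comp : ∀ {k r : ℕ} (n : Fin k → ℕ) (_ : ∑ i, n i = r),
    obj k →ₗ[𝕜] MultilinearMap 𝕜 (fun i => obj (n i)) (obj r)
  one_comp : ∀ {r : ℕ} (x : obj r),
    comp (fun _ : Fin 1 => r) (by simp) one (fun _ => x) = x
  comp_one : ∀ {k : ℕ} (p : obj k),
    comp (fun _ : Fin k => 1) (by simp) p (fun _ => one) = p
  comp_assoc : ∀ {k r : ℕ} (l : Fin k → ℕ) (n : ∀ i, Fin (l i) → ℕ) (m : Fin k → ℕ)
    (hm : ∀ i, ∑ j, n i j = m i) (hr : ∑ i, m i = r)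
    (p : obj k) (q : ∀ i, obj (l i)) (x : ∀ i j, obj (n i j)),
    comp (fun s => n (finSigmaFinEquiv.symm s).1 (finSigmaFinEquiv.symm s).2)
        (sum_lex l n m hm hr) (comp l rfl p q)
        (fun s => x (finSigmaFinEquiv.symm s).1 (finSigmaFinEquiv.symm s).2) =
      comp m hr p (fun i => comp (n i) (hm i) (q i) (x i))

namespace NSOperad

variable {𝕜 : Type u} [Field 𝕜]

/-- A morphism of nonsymmetric operads. -/
@[ext]
structure Hom (P : NSOperad.{u, v} 𝕜) (Q : NSOperad.{u, w} 𝕜) where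
  toFun : ∀ n, P.obj n →ₗ[𝕜] Q.obj n
  map_one : toFun 1 P.one = Q.one
  map_comp : ∀ {k r : ℕ} (n : Fin k → ℕ) (h : ∑ i, n i = r) (p : P.obj k)
    (q : ∀ i, P.obj (n i)),
    toFun r (P.comp n h p q) = Q.comp n h (toFun k p) (fun i => toFun (n i) (q i))

/-- A left module over a nonsymmetric operad `P`: a collection `M` with action maps
`P(k) ⊗ M(n₁) ⊗ … ⊗ M(n_k) → M(n₁ + … + n_k)`, that is `P ∘ M → M`, which are unital and
associative. -/
structure LeftModule (P : NSOperad.{u, v} 𝕜) extends NSCollection.{u, w} 𝕜 where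
  act : ∀ {k r : ℕ} (n : Fin k → ℕ) (_ : ∑ i, n i = r),
    P.obj k →ₗ[𝕜] MultilinearMap 𝕜 (fun i => obj (n i)) (obj r)
  one_act : ∀ {r : ℕ} (x : obj r),
    act (fun _ : Fin 1 => r) (by simp) P.one (fun _ => x) = x
  act_assoc : ∀ {k r : ℕ} (l : Fin k → ℕ) (n : ∀ i, Fin (l i) → ℕ) (m : Fin k → ℕ)
    (hm : ∀ i, ∑ j, n i j = m i) (hr : ∑ i, m i = r)
    (p : P.obj k) (q : ∀ i, P.obj (l i)) (x : ∀ i j, obj (n i j)),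
    act (fun s => n (finSigmaFinEquiv.symm s).1 (finSigmaFinEquiv.symm s).2)
        (sum_lex l n m hm hr) (P.comp l rfl p q)
        (fun s => x (finSigmaFinEquiv.symm s).1 (finSigmaFinEquiv.symm s).2) =
      act m hr p (fun i => act (n i) (hm i) (q i) (x i))

/-- A morphism of operads `φ : P → Q` makes `Q` a left `P`-module:
`p · (q₁, …, q_k) = φ(p) (q₁, …, q_k)`. -/
def Hom.leftModule {P : NSOperad.{u, v} 𝕜} {Q : NSOperad.{u, w} 𝕜} (φ : Hom P Q) :
    LeftModule.{u, v, w} P where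
  toNSCollection := Q.toNSCollection
  act {k _} n h := Q.comp n h ∘ₗ φ.toFun k
  one_act x := by
    simp only [LinearMap.comp_apply, φ.map_one]
    exact Q.one_comp x
  act_assoc l n m hm hr p q x := by
    simp only [LinearMap.comp_apply, φ.map_comp]
    exact Q.comp_assoc l n m hm hr (φ.toFun _ p) (fun i => φ.toFun _ (q i)) x

end NSOperad

/-- The nonsymmetric composition `P ∘ K`: the component of arity `r` is the direct sum, over all
`r = n₁ + … + n_k` with positive `n_i` (equivalently, over all `k` and all non-decreasing
surjections `[r] → [k]`), of `P(k) ⊗ K(n₁) ⊗ … ⊗ K(n_k)`. -/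
noncomputable def NSCollection.circ {𝕜 : Type u} [Field 𝕜] (P : NSCollection.{u, v} 𝕜)
    (K : NSCollection.{u, w} 𝕜) : NSCollection 𝕜 where
  obj r := ⨁ c : Composition r,
    P.obj c.length ⊗[𝕜] (⨂[𝕜] i : Fin c.length, K.obj (c.blocksFun i))
  subsingleton_zero := by
    have : ∀ c : Composition 0, Subsingleton
        (P.obj c.length ⊗[𝕜] (⨂[𝕜] i : Fin c.length, K.obj (c.blocksFun i))) := by
      intro c
      have h : c.length = 0 := Nat.le_zero.mp c.length_le
      have h0 : Subsingleton (P.obj c.length) := by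
        rw [h]; exact P.subsingleton_zero
      refine ⟨fun a b => ?_⟩
      have key : ∀ z : P.obj c.length ⊗[𝕜] (⨂[𝕜] i : Fin c.length, K.obj (c.blocksFun i)),
          z = 0 := by
        intro z
        induction z with
        | zero => rfl
        | tmul p t => rw [Subsingleton.elim p 0, TensorProduct.zero_tmul]
        | add y z hy hz => rw [hy, hz, add_zero]
      rw [key a, key b]
    refine ⟨fun a b => DFinsupp.ext fun c => Subsingleton.elim _ _⟩

namespace NSOperad.LeftModule

variable {𝕜 : Type u} [Field 𝕜] {P : NSOperad.{u, v} 𝕜}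

/-- The morphism of left `P`-modules `P ∘ K → M` induced by a morphism of collections `ι : K → M`:
`p ⊗ x₁ ⊗ … ⊗ x_k ↦ p · (ι x₁, …, ι x_k)`. -/
noncomputable def inducedHom (M : LeftModule.{u, v, w} P) (K : NSCollection.{u, w} 𝕜)
    (ι : NSCollection.Hom K M.toNSCollection) :
    NSCollection.Hom (P.toNSCollection.circ K) M.toNSCollection where
  toFun r := DirectSum.toModule 𝕜 (Composition r) (M.obj r) fun c =>
    TensorProduct.lift
      { toFun := fun p => PiTensorProduct.lift
          ((M.act c.blocksFun c.sum_blocksFun p).compLinearMap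
            fun i => ι.toFun (c.blocksFun i))
        map_add' := by
          intro p q
          rw [← map_add, map_add]
          rfl
        map_smul' := by
          intro a p
          rw [RingHom.id_apply, ← map_smul, map_smul]
          rfl }

/-- A left `P`-module `M` is free if there are a collection `K` and a morphism of collections
`K → M` for which the induced morphism of left `P`-modules `P ∘ K → M` is an isomorphism. -/
def IsFree (M : LeftModule.{u, v, w} P) : Prop :=
  ∃ (K : NSCollection.{u, w} 𝕜) (ι : NSCollection.Hom K M.toNSCollection),
    ∀ r, Function.Bijective ((inducedHom M K ι).toFun r)

end NSOperad.LeftModule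

/-! ### Ideals and quotients of operads -/

namespace NSOperad

variable {𝕜 : Type u} [Field 𝕜]

/-- A (two-sided) ideal of a nonsymmetric operad: a subcollection that contains every composite one
of whose factors belongs to it. -/
structure OpIdeal (P : NSOperad.{u, v} 𝕜) where
  carrier : ∀ n, Submodule 𝕜 (P.obj n)
  comp_left : ∀ {k r : ℕ} (n : Fin k → ℕ) (h : ∑ i, n i = r) (p : P.obj k)
    (q : ∀ i, P.obj (n i)), p ∈ carrier k → P.comp n h p q ∈ carrier r
  comp_right : ∀ {k r : ℕ} (n : Fin k → ℕ) (h : ∑ i, n i = r) (p : P.obj k)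
    (q : ∀ i, P.obj (n i)) (i : Fin k), q i ∈ carrier (n i) → P.comp n h p q ∈ carrier r

/-- The ideal generated by a family of relations: the smallest ideal that contains them. -/
def OpIdeal.span (P : NSOperad.{u, v} 𝕜) (R : ∀ n, Set (P.obj n)) : OpIdeal P where
  carrier n := sInf {S | ∃ J : OpIdeal P, (∀ m, R m ⊆ J.carrier m) ∧ S = J.carrier n}
  comp_left n h p q hp := by
    simp only [Submodule.mem_sInf] at hp ⊢
    rintro S ⟨J, hJ, rfl⟩
    exact J.comp_left n h p q (hp _ ⟨J, hJ, rfl⟩)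
  comp_right n h p q i hq := by
    simp only [Submodule.mem_sInf] at hq ⊢
    rintro S ⟨J, hJ, rfl⟩
    exact J.comp_right n h p q i (hq _ ⟨J, hJ, rfl⟩)

theorem OpIdeal.comp_sub_mem {P : NSOperad.{u, v} 𝕜} (I : OpIdeal P) {k r : ℕ} (n : Fin k → ℕ)
    (h : ∑ i, n i = r) (p : P.obj k) (q q' : ∀ i, P.obj (n i))
    (hq : ∀ i, q i - q' i ∈ I.carrier (n i)) :
    P.comp n h p q - P.comp n h p q' ∈ I.carrier r := by
  classical
  have key : ∀ s : Finset (Fin k),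
      P.comp n h p (s.piecewise q q') - P.comp n h p q' ∈ I.carrier r := by
    intro s
    induction s using Finset.induction_on with
    | empty => simp
    | insert a s ha ih =>
      have h1 : P.comp n h p ((insert a s).piecewise q q') -
          P.comp n h p (s.piecewise q q') ∈ I.carrier r := by
        have e1 : s.piecewise q q' = Function.update (s.piecewise q q') a (q' a) := by
          rw [Function.eq_update_iff]
          exact ⟨by simp [ha], fun _ _ => rfl⟩
        have e2 : (insert a s).piecewise q q' = Function.update (s.piecewise q q') a (q a) :=
          Finset.piecewise_insert s q q' a
        have e3 : P.comp n h p (s.piecewise q q') =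
            P.comp n h p (Function.update (s.piecewise q q') a (q' a)) := congrArg _ e1
        rw [e2, e3, ← MultilinearMap.map_update_sub]
        exact I.comp_right n h p _ a (by simpa using hq a)
      simpa using add_mem h1 ih
  simpa using key Finset.univ

namespace OpIdeal

variable {P : NSOperad.{u, v} 𝕜} (I : OpIdeal P)

/-- A chosen representative of a class modulo `I`. -/
noncomputable def rep {n : ℕ} : (P.obj n ⧸ I.carrier n) → P.obj n :=
  Function.surjInv (I.carrier n).mkQ_surjective

theorem mkQ_rep {n : ℕ} (x : P.obj n ⧸ I.carrier n) : (I.carrier n).mkQ (I.rep x) = x :=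
  Function.surjInv_eq (I.carrier n).mkQ_surjective x

theorem mkQ_comp_congr {k r : ℕ} (n : Fin k → ℕ) (h : ∑ i, n i = r) (p : P.obj k)
    (q q' : ∀ i, P.obj (n i))
    (hq : ∀ i, (I.carrier (n i)).mkQ (q i) = (I.carrier (n i)).mkQ (q' i)) :
    (I.carrier r).mkQ (P.comp n h p q) = (I.carrier r).mkQ (P.comp n h p q') :=
  (Submodule.Quotient.eq _).2
    (I.comp_sub_mem n h p q q' fun i => (Submodule.Quotient.eq _).1 (hq i))

theorem mkQ_comp_rep_update {k r : ℕ} (n : Fin k → ℕ) (h : ∑ i, n i = r) (p : P.obj k)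
    [DecidableEq (Fin k)] (q : ∀ i, P.obj (n i) ⧸ I.carrier (n i)) (i : Fin k)
    (z : P.obj (n i) ⧸ I.carrier (n i)) (z' : P.obj (n i))
    (hz : (I.carrier (n i)).mkQ z' = z) :
    (I.carrier r).mkQ (P.comp n h p fun j => I.rep (Function.update q i z j)) =
      (I.carrier r).mkQ (P.comp n h p (Function.update (fun j => I.rep (q j)) i z')) := by
  refine I.mkQ_comp_congr n h p _ _ fun j => ?_
  by_cases hj : j = i
  · subst hj; simp only [Function.update_self, mkQ_rep, hz]
  · simp only [Function.update_of_ne hj]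

/-- The composition with a fixed outer operation, induced on classes of inner operations. -/
noncomputable def compRight {k r : ℕ} (n : Fin k → ℕ) (h : ∑ i, n i = r) (p : P.obj k) :
    MultilinearMap 𝕜 (fun i => P.obj (n i) ⧸ I.carrier (n i)) (P.obj r ⧸ I.carrier r) where
  toFun q := (I.carrier r).mkQ (P.comp n h p fun i => I.rep (q i))
  map_update_add' q i x y := by
    rw [I.mkQ_comp_rep_update n h p q i _ (I.rep x + I.rep y) (by rw [map_add, mkQ_rep, mkQ_rep]),
      I.mkQ_comp_rep_update n h p q i x (I.rep x) (I.mkQ_rep x),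
      I.mkQ_comp_rep_update n h p q i y (I.rep y) (I.mkQ_rep y),
      MultilinearMap.map_update_add, map_add]
  map_update_smul' q i a x := by
    rw [I.mkQ_comp_rep_update n h p q i _ (a • I.rep x) (by rw [map_smul, mkQ_rep]),
      I.mkQ_comp_rep_update n h p q i x (I.rep x) (I.mkQ_rep x),
      MultilinearMap.map_update_smul, map_smul]

/-- The composition of classes modulo `I`. -/
noncomputable def compQuot {k r : ℕ} (n : Fin k → ℕ) (h : ∑ i, n i = r) :
    (P.obj k ⧸ I.carrier k) →ₗ[𝕜]
      MultilinearMap 𝕜 (fun i => P.obj (n i) ⧸ I.carrier (n i)) (P.obj r ⧸ I.carrier r) :=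
  (I.carrier k).liftQ
    { toFun := I.compRight n h
      map_add' := fun p p' => MultilinearMap.ext fun q => by
        simp [compRight]
      map_smul' := fun a p => MultilinearMap.ext fun q => by
        simp [compRight] }
    (fun p hp => LinearMap.mem_ker.2 (MultilinearMap.ext fun _ =>
      (Submodule.Quotient.mk_eq_zero _).2 (I.comp_left n h p _ hp)))

theorem compQuot_mkQ {k r : ℕ} (n : Fin k → ℕ) (h : ∑ i, n i = r) (p : P.obj k)
    (q : ∀ i, P.obj (n i)) :
    I.compQuot n h ((I.carrier k).mkQ p) (fun i => (I.carrier (n i)).mkQ (q i)) =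
      (I.carrier r).mkQ (P.comp n h p q) :=
  I.mkQ_comp_congr n h p _ _ fun _ => I.mkQ_rep _

end OpIdeal

/-- The quotient of a nonsymmetric operad by an ideal, with the composition induced on classes. -/
noncomputable def quotient (P : NSOperad.{u, v} 𝕜) (I : OpIdeal P) : NSOperad.{u, v} 𝕜 where
  obj n := P.obj n ⧸ I.carrier n
  subsingleton_zero := by
    have := P.subsingleton_zero
    exact (I.carrier 0).mkQ_surjective.subsingleton
  one := (I.carrier 1).mkQ P.one
  comp n h := I.compQuot n h
  one_comp {r} x := by
    obtain ⟨x, rfl⟩ := (I.carrier r).mkQ_surjective x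
    exact (I.compQuot_mkQ _ _ _ (fun _ => x)).trans (by rw [P.one_comp])
  comp_one {k} p := by
    obtain ⟨p, rfl⟩ := (I.carrier k).mkQ_surjective p
    exact (I.compQuot_mkQ _ _ _ (fun _ => P.one)).trans (by rw [P.comp_one])
  comp_assoc {k r} l n m hm hr p q x := by
    obtain ⟨p, rfl⟩ := (I.carrier k).mkQ_surjective p
    obtain ⟨q, rfl⟩ : ∃ q' : ∀ i, P.obj (l i), q = fun i => (I.carrier (l i)).mkQ (q' i) :=
      ⟨fun i => I.rep (q i), funext fun i => (I.mkQ_rep _).symm⟩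
    obtain ⟨x, rfl⟩ : ∃ x' : ∀ i j, P.obj (n i j),
        x = fun i j => (I.carrier (n i j)).mkQ (x' i j) :=
      ⟨fun i j => I.rep (x i j), funext fun i => funext fun j => (I.mkQ_rep _).symm⟩
    simp only [OpIdeal.compQuot_mkQ]
    exact congrArg _ (P.comp_assoc l n m hm hr p q x)

/-- The projection of an operad onto its quotient by an ideal. -/
noncomputable def quotientHom (P : NSOperad.{u, v} 𝕜) (I : OpIdeal P) : Hom P (P.quotient I) where
  toFun n := (I.carrier n).mkQ
  map_one := rfl
  map_comp n h p q := (I.compQuot_mkQ n h p q).symm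

end NSOperad

/-! ### The free nonsymmetric operad on a set of binary operations -/

/-- Planar binary rooted trees whose internal vertices are labelled by elements of `E`. -/
inductive BinTree (E : Type) : Type
  | leaf : BinTree E
  | node : E → BinTree E → BinTree E → BinTree E

namespace BinTree

variable {E : Type}

/-- The number of leaves. -/
def leaves : BinTree E → ℕ
  | leaf => 1
  | node _ l r => l.leaves + r.leaves

/-- `t.graft f` is the tree obtained from `t` by grafting the tree `f i` at the leaf number `i`; the
leaves of `t` are numbered from left to right, starting with `0`. -/
def graft : BinTree E → (ℕ → BinTree E) → BinTree E
  | leaf, f => f 0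
  | node e l r, f => node e (l.graft f) (r.graft fun i => f (l.leaves + i))

theorem leaves_pos (t : BinTree E) : 0 < t.leaves := by
  induction t with
  | leaf => exact Nat.one_pos
  | node e l r hl hr => exact Nat.add_pos_left hl _

theorem graft_congr (t : BinTree E) (f g : ℕ → BinTree E) (h : ∀ i < t.leaves, f i = g i) :
    t.graft f = t.graft g := by
  induction t generalizing f g with
  | leaf => exact h 0 Nat.one_pos
  | node e l r hl hr =>
    simp only [leaves] at h
    simp only [graft]
    rw [hl f g fun i hi => h i (by omega), hr _ _ fun i hi => h _ (by omega)]

theorem graft_leaf (t : BinTree E) : (t.graft fun _ => leaf) = t := by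
  induction t with
  | leaf => rfl
  | node e l r hl hr => simp only [graft, hl, hr]

theorem leaves_graft (t : BinTree E) (f : ℕ → BinTree E) :
    (t.graft f).leaves = ∑ i ∈ Finset.range t.leaves, (f i).leaves := by
  induction t generalizing f with
  | leaf => simp [graft, leaves]
  | node e l r hl hr => simp only [graft, leaves, hl, hr, Finset.sum_range_add]

theorem graft_graft (t : BinTree E) (f g : ℕ → BinTree E) :
    (t.graft f).graft g = t.graft fun i =>
      (f i).graft fun j => g (∑ a ∈ Finset.range i, (f a).leaves + j) := by
  induction t generalizing f g with
  | leaf => simp [graft]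
  | node e l r hl hr =>
    simp only [graft, hl, hr, leaves_graft, Finset.sum_range_add, add_assoc]

/-- The extension of a finite sequence of trees by trivial trees. -/
def extend {k : ℕ} (s : Fin k → BinTree E) (i : ℕ) : BinTree E :=
  if h : i < k then s ⟨i, h⟩ else leaf

theorem extend_val {k : ℕ} (s : Fin k → BinTree E) (i : Fin k) : extend s i = s i := by
  simp [extend]

/-- Trees with `n` leaves. -/
def OfArity (E : Type) (n : ℕ) : Type := {t : BinTree E // t.leaves = n}

/-- The trivial tree. -/
def OfArity.leaf : OfArity E 1 := ⟨BinTree.leaf, rfl⟩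

/-- Grafting of `k` trees, with `n₁, …, n_k` leaves, at the leaves of a tree with `k` leaves. -/
def OfArity.graft {k r : ℕ} (n : Fin k → ℕ) (h : ∑ i, n i = r) (t : OfArity E k)
    (s : ∀ i, OfArity E (n i)) : OfArity E r :=
  ⟨t.1.graft (extend fun i => (s i).1), by
    rw [leaves_graft, t.2, Finset.sum_range, ← h]
    exact Finset.sum_congr rfl fun i _ => by rw [extend_val, (s i).2]⟩

theorem OfArity.graft_assoc {k r : ℕ} (l : Fin k → ℕ) (n : ∀ i, Fin (l i) → ℕ) (m : Fin k → ℕ)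
    (hm : ∀ i, ∑ j, n i j = m i) (hr : ∑ i, m i = r) (p : OfArity E k)
    (q : ∀ i, OfArity E (l i)) (x : ∀ i j, OfArity E (n i j)) :
    OfArity.graft (fun s => n (finSigmaFinEquiv.symm s).1 (finSigmaFinEquiv.symm s).2)
        (sum_lex l n m hm hr) (OfArity.graft l rfl p q)
        (fun s => x (finSigmaFinEquiv.symm s).1 (finSigmaFinEquiv.symm s).2) =
      OfArity.graft m hr p (fun i => OfArity.graft (n i) (hm i) (q i) (x i)) := by
  apply Subtype.ext
  simp only [OfArity.graft, graft_graft]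
  refine graft_congr _ _ _ fun i hi => ?_
  rw [p.2] at hi
  have h1 : ∀ s : Fin k → BinTree E, extend s i = s ⟨i, hi⟩ := fun s => dif_pos hi
  rw [h1, h1]
  refine graft_congr _ _ _ fun j hj => ?_
  rw [(q ⟨i, hi⟩).2] at hj
  have h2 : ∑ a ∈ Finset.range i, (extend (fun i => (q i).1) a).leaves + j =
      (finSigmaFinEquiv (⟨⟨i, hi⟩, ⟨j, hj⟩⟩ : (i : Fin k) × Fin (l i)) : ℕ) := by
    rw [finSigmaFinEquiv_apply, Finset.sum_range]
    congr 1
    refine Finset.sum_congr rfl fun a _ => ?_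
    have ha : (a : ℕ) < k := a.2.trans hi
    have h3 : extend (fun i => (q i).1) (a : ℕ) = (q ⟨a, ha⟩).1 := dif_pos ha
    rw [h3, (q ⟨a, ha⟩).2]
    rfl
  rw [h2, extend_val, Equiv.symm_apply_apply]
  have h4 : ∀ s : Fin (l ⟨i, hi⟩) → BinTree E, s ⟨j, hj⟩ = extend s j := by
    intro s
    rw [extend, dif_pos hj]
  exact h4 fun j => (x ⟨i, hi⟩ j).1

end BinTree

open scoped Classical in
/-- The multilinear map on free modules with prescribed values on basis vectors. -/
noncomputable def multilinearOfBasis (𝕜 : Type u) [Field 𝕜] {k : ℕ} {κ : Fin k → Type}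
    {N : Type v} [AddCommGroup N] [Module 𝕜 N] (b : (∀ i, κ i) → N) :
    MultilinearMap 𝕜 (fun i => κ i →₀ 𝕜) N :=
  (MultilinearMap.fromDFinsuppEquiv κ 𝕜
    (fun p => MultilinearMap.mkPiRing 𝕜 (Fin k) (b p))).compLinearMap
      fun _ => (finsuppLequivDFinsupp 𝕜).toLinearMap

theorem multilinearOfBasis_single (𝕜 : Type u) [Field 𝕜] {k : ℕ} {κ : Fin k → Type}
    {N : Type v} [AddCommGroup N] [Module 𝕜 N] (b : (∀ i, κ i) → N) (s : ∀ i, κ i) :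
    multilinearOfBasis 𝕜 b (fun i => Finsupp.single (s i) 1) = b s := by
  classical
  simp only [multilinearOfBasis, MultilinearMap.compLinearMap_apply, LinearEquiv.coe_coe,
    finsuppLequivDFinsupp_apply_apply, Finsupp.toDFinsupp_single]
  refine (MultilinearMap.fromDFinsuppEquiv_single _ s _).trans ?_
  simp

/-- Reindexing the arguments of a multilinear map along a bijection. -/
def reindexArgs {𝕜 : Type u} [Field 𝕜] {α β : Type} (e : α ≃ β)
    {M : β → Type v} [∀ b, AddCommGroup (M b)] [∀ b, Module 𝕜 (M b)]
    {N : Type w} [AddCommGroup N] [Module 𝕜 N]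
    (f : MultilinearMap 𝕜 (fun a => M (e a)) N) : MultilinearMap 𝕜 M N where
  toFun x := f fun a => x (e a)
  map_update_add' {_} x i y z := by
    classical
    obtain ⟨a, rfl⟩ := e.surjective i
    have h : ∀ y, (fun a' => Function.update x (e a) y (e a')) =
        Function.update (fun a' => x (e a')) a y := by
      intro y
      funext a'
      by_cases h : a' = a
      · subst h; simp
      · simp [h]
    simp only [h, MultilinearMap.map_update_add]
  map_update_smul' {_} x i c y := by
    classical
    obtain ⟨a, rfl⟩ := e.surjective i
    have h : ∀ y, (fun a' => Function.update x (e a) y (e a')) =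
        Function.update (fun a' => x (e a')) a y := by
      intro y
      funext a'
      by_cases h : a' = a
      · subst h; simp
      · simp [h]
    simp only [h, MultilinearMap.map_update_smul]

namespace FreeBinary

variable (𝕜 : Type u) [Field 𝕜] {E : Type}

/-- The composition in the free operad: the multilinear extension of the grafting of trees. -/
noncomputable def comp {k r : ℕ} (n : Fin k → ℕ) (h : ∑ i, n i = r) :
    (BinTree.OfArity E k →₀ 𝕜) →ₗ[𝕜]
      MultilinearMap 𝕜 (fun i => BinTree.OfArity E (n i) →₀ 𝕜) (BinTree.OfArity E r →₀ 𝕜) :=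
  Finsupp.linearCombination 𝕜 fun t =>
    multilinearOfBasis 𝕜 fun s => Finsupp.single (BinTree.OfArity.graft n h t s) 1

theorem comp_single {k r : ℕ} (n : Fin k → ℕ) (h : ∑ i, n i = r) (t : BinTree.OfArity E k)
    (s : ∀ i, BinTree.OfArity E (n i)) :
    comp 𝕜 n h (Finsupp.single t 1) (fun i => Finsupp.single (s i) 1) =
      Finsupp.single (BinTree.OfArity.graft n h t s) 1 := by
  simp [comp, multilinearOfBasis_single]

theorem one_comp {r : ℕ} (h : ∑ _ : Fin 1, r = r) (x : BinTree.OfArity E r →₀ 𝕜) :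
    comp 𝕜 (fun _ : Fin 1 => r) h (Finsupp.single BinTree.OfArity.leaf 1) (fun _ => x) = x := by
  have key : comp 𝕜 (fun _ : Fin 1 => r) h
      (Finsupp.single BinTree.OfArity.leaf 1) =
      MultilinearMap.ofSubsingleton 𝕜 (BinTree.OfArity E r →₀ 𝕜) _ (0 : Fin 1) LinearMap.id := by
    refine Module.Basis.ext_multilinear (fun _ => Finsupp.basisSingleOne) fun s => ?_
    simp only [Finsupp.coe_basisSingleOne, MultilinearMap.ofSubsingleton_apply_apply,
      LinearMap.id_apply]
    exact comp_single 𝕜 (fun _ : Fin 1 => r) h .leaf s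
  rw [key]
  rfl

theorem comp_one {k : ℕ} (h : ∑ _ : Fin k, 1 = k) (p : BinTree.OfArity E k →₀ 𝕜) :
    comp 𝕜 (fun _ : Fin k => 1) h p (fun _ => Finsupp.single BinTree.OfArity.leaf 1) = p := by
  induction p using Finsupp.induction_linear with
  | zero => rw [map_zero, _root_.zero_apply]
  | add p q hp hq => rw [map_add, _root_.add_apply, hp, hq]
  | single t a =>
    have ha : Finsupp.single t a = a • Finsupp.single t (1 : 𝕜) := by simp
    rw [ha, map_smul, _root_.smul_apply]
    refine congrArg (a • ·) ((comp_single 𝕜 _ h t fun _ => .leaf).trans ?_)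
    congr 1
    apply Subtype.ext
    refine (BinTree.graft_congr _ _ _ fun i _ => ?_).trans (BinTree.graft_leaf t.1)
    simp [BinTree.extend, BinTree.OfArity.leaf]

/-- The composition as a linear function of the outer operation. -/
noncomputable def compLeft {k r : ℕ} (n : Fin k → ℕ) (h : ∑ i, n i = r)
    (x : ∀ i, BinTree.OfArity E (n i) →₀ 𝕜) :
    (BinTree.OfArity E k →₀ 𝕜) →ₗ[𝕜] (BinTree.OfArity E r →₀ 𝕜) where
  toFun y := comp 𝕜 n h y x
  map_add' y z := by rw [map_add, _root_.add_apply]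
  map_smul' a y := by rw [map_smul, _root_.smul_apply, RingHom.id_apply]

theorem comp_assoc {k r : ℕ} (l : Fin k → ℕ) (n : ∀ i, Fin (l i) → ℕ) (m : Fin k → ℕ)
    (hm : ∀ i, ∑ j, n i j = m i) (hr : ∑ i, m i = r)
    (p : BinTree.OfArity E k →₀ 𝕜) (q : ∀ i, BinTree.OfArity E (l i) →₀ 𝕜)
    (x : ∀ i j, BinTree.OfArity E (n i j) →₀ 𝕜) :
    comp 𝕜 (fun s => n (finSigmaFinEquiv.symm s).1 (finSigmaFinEquiv.symm s).2)
        (sum_lex l n m hm hr) (comp 𝕜 l rfl p q)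
        (fun s => x (finSigmaFinEquiv.symm s).1 (finSigmaFinEquiv.symm s).2) =
      comp 𝕜 m hr p (fun i => comp 𝕜 (n i) (hm i) (q i) (x i)) := by
  have step1 : ∀ (t : BinTree.OfArity E k) (s : ∀ i, BinTree.OfArity E (l i)),
      reindexArgs finSigmaFinEquiv.symm
        (M := fun σ : (i : Fin k) × Fin (l i) => BinTree.OfArity E (n σ.1 σ.2) →₀ 𝕜)
        (comp 𝕜 (fun s => n (finSigmaFinEquiv.symm s).1 (finSigmaFinEquiv.symm s).2)
          (sum_lex l n m hm hr)
          (comp 𝕜 l rfl (Finsupp.single t 1) (fun i => Finsupp.single (s i) 1))) =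
      (comp 𝕜 m hr (Finsupp.single t 1)).compMultilinearMap
        (fun i => comp 𝕜 (n i) (hm i) (Finsupp.single (s i) 1)) := by
    intro t s
    refine Module.Basis.ext_multilinear (fun _ => Finsupp.basisSingleOne) fun y => ?_
    simp only [Finsupp.coe_basisSingleOne]
    have h1 := BinTree.OfArity.graft_assoc l n m hm hr t s fun i j => y ⟨i, j⟩
    have h2 := comp_single 𝕜 _ (sum_lex l n m hm hr) (BinTree.OfArity.graft l rfl t s)
      (fun s => y (finSigmaFinEquiv.symm s))
    have h3 := comp_single 𝕜 _ hr t
      (fun i => BinTree.OfArity.graft (n i) (hm i) (s i) fun j => y ⟨i, j⟩)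
    have h4 : ∀ i, comp 𝕜 (n i) (hm i) (Finsupp.single (s i) 1)
        (fun j => Finsupp.single (y ⟨i, j⟩) 1) = _ := fun i => comp_single 𝕜 _ (hm i) (s i) _
    rw [comp_single]
    refine h2.trans (Eq.trans ?_ (h3.symm.trans ?_))
    · exact congrArg (fun z => Finsupp.single z (1 : 𝕜)) h1
    · exact congrArg _ (funext fun i => (h4 i).symm)
  have step2 : ∀ t : BinTree.OfArity E k,
      (compLeft 𝕜 (fun s => n (finSigmaFinEquiv.symm s).1 (finSigmaFinEquiv.symm s).2)
        (sum_lex l n m hm hr)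
        (fun s => x (finSigmaFinEquiv.symm s).1 (finSigmaFinEquiv.symm s).2)).compMultilinearMap
          (comp 𝕜 l rfl (Finsupp.single t 1)) =
      (comp 𝕜 m hr (Finsupp.single t 1)).compLinearMap
        (fun i => compLeft 𝕜 (n i) (hm i) (x i)) := by
    intro t
    refine Module.Basis.ext_multilinear (fun _ => Finsupp.basisSingleOne) fun s => ?_
    simp only [Finsupp.coe_basisSingleOne]
    exact DFunLike.congr_fun (step1 t s) fun σ : (i : Fin k) × Fin (l i) => x σ.1 σ.2
  induction p using Finsupp.induction_linear with
  | zero => simp only [map_zero, _root_.zero_apply]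
  | add p p' hp hp' => simp only [map_add, _root_.add_apply, hp, hp']
  | single t a =>
    have ha : Finsupp.single t a = a • Finsupp.single t (1 : 𝕜) := by simp
    simp only [ha, map_smul, _root_.smul_apply]
    exact congrArg _ (DFunLike.congr_fun (step2 t) q)

end FreeBinary

/-- The free nonsymmetric operad generated by a set `E` of binary operations: its component of arity
`n` has as a basis the planar binary trees with `n` leaves and internal vertices labelled by `E`,
and the composition is the grafting of trees. -/
noncomputable def freeBinary (𝕜 : Type u) [Field 𝕜] (E : Type) : NSOperad.{u, u} 𝕜 where
  obj n := BinTree.OfArity E n →₀ 𝕜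
  subsingleton_zero := by
    have : IsEmpty (BinTree.OfArity E 0) := ⟨fun t => t.1.leaves_pos.ne' t.2⟩
    infer_instance
  one := Finsupp.single BinTree.OfArity.leaf 1
  comp n h := FreeBinary.comp 𝕜 n h
  one_comp x := FreeBinary.one_comp 𝕜 _ x
  comp_one p := FreeBinary.comp_one 𝕜 _ p
  comp_assoc l n m hm hr p q x := FreeBinary.comp_assoc 𝕜 l n m hm hr p q x

namespace freeBinary

variable (𝕜 : Type u) [Field 𝕜] {E : Type}

/-- The generating operation `e`, that is `e(a₁, a₂)`. -/
noncomputable def gen (e : E) : (freeBinary 𝕜 E).obj 2 :=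
  Finsupp.single ⟨.node e .leaf .leaf, rfl⟩ (1 : 𝕜)

/-- The tree monomial `e(f(a₁, a₂), a₃)`. -/
noncomputable def left (e f : E) : (freeBinary 𝕜 E).obj 3 :=
  Finsupp.single ⟨.node e (.node f .leaf .leaf) .leaf, rfl⟩ (1 : 𝕜)

/-- The tree monomial `e(a₁, f(a₂, a₃))`. -/
noncomputable def right (e f : E) : (freeBinary 𝕜 E).obj 3 :=
  Finsupp.single ⟨.node e .leaf (.node f .leaf .leaf), rfl⟩ (1 : 𝕜)

end freeBinary

/-! ### The operads `As` and `Dend` -/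

/-- The associativity relation `(a₁ a₂) a₃ = a₁ (a₂ a₃)`. -/
inductive AsRel (𝕜 : Type u) [Field 𝕜] : ∀ n, Set ((freeBinary 𝕜 Unit).obj n)
  | assoc : AsRel 𝕜 3 (freeBinary.left 𝕜 () () - freeBinary.right 𝕜 () ())

/-- The nonsymmetric operad of associative algebras (without unit). -/
noncomputable def As (𝕜 : Type u) [Field 𝕜] : NSOperad.{u, u} 𝕜 :=
  (freeBinary 𝕜 Unit).quotient (.span _ (AsRel 𝕜))

/-- The associative product, the generator of `As`. -/
noncomputable def As.mul (𝕜 : Type u) [Field 𝕜] : (As 𝕜).obj 2 :=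
  ((freeBinary 𝕜 Unit).quotientHom _).toFun 2 (freeBinary.gen 𝕜 ())

/-- The two generating operations `≺` and `≻` of the dendriform operad. -/
inductive DendGen : Type
  | prec
  | succ

open freeBinary DendGen in
/-- The dendriform relations
`(a₁ ≺ a₂) ≺ a₃ = a₁ ≺ (a₂ ≺ a₃) + a₁ ≺ (a₂ ≻ a₃)`,
`(a₁ ≻ a₂) ≺ a₃ = a₁ ≻ (a₂ ≺ a₃)`,
`(a₁ ≺ a₂) ≻ a₃ + (a₁ ≻ a₂) ≻ a₃ = a₁ ≻ (a₂ ≻ a₃)`. -/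
inductive DendRel (𝕜 : Type u) [Field 𝕜] : ∀ n, Set ((freeBinary 𝕜 DendGen).obj n)
  | prec_prec : DendRel 𝕜 3 (left 𝕜 prec prec - (right 𝕜 prec prec + right 𝕜 prec succ))
  | succ_prec : DendRel 𝕜 3 (left 𝕜 prec succ - right 𝕜 succ prec)
  | succ_succ : DendRel 𝕜 3 (left 𝕜 succ prec + left 𝕜 succ succ - right 𝕜 succ succ)

/-- The nonsymmetric dendriform operad. -/
noncomputable def Dend (𝕜 : Type u) [Field 𝕜] : NSOperad.{u, u} 𝕜 :=
  (freeBinary 𝕜 DendGen).quotient (.span _ (DendRel 𝕜))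

/-- The operation `≺` of `Dend`. -/
noncomputable def Dend.prec (𝕜 : Type u) [Field 𝕜] : (Dend 𝕜).obj 2 :=
  ((freeBinary 𝕜 DendGen).quotientHom _).toFun 2 (freeBinary.gen 𝕜 .prec)

/-- The operation `≻` of `Dend`. -/
noncomputable def Dend.succ (𝕜 : Type u) [Field 𝕜] : (Dend 𝕜).obj 2 :=
  ((freeBinary 𝕜 DendGen).quotientHom _).toFun 2 (freeBinary.gen 𝕜 .succ)

/-! ### Dendriform algebras and associative algebras -/

/-- A dendriform algebra structure on a vector space `D`. -/
class DendriformAlgebra (𝕜 : Type u) [Field 𝕜] (D : Type v) [AddCommGroup D] [Module 𝕜 D] where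
  prec : D →ₗ[𝕜] D →ₗ[𝕜] D
  succ : D →ₗ[𝕜] D →ₗ[𝕜] D
  prec_prec : ∀ a b c, prec (prec a b) c = prec a (prec b c) + prec a (succ b c)
  succ_prec : ∀ a b c, prec (succ a b) c = succ a (prec b c)
  succ_succ : ∀ a b c, succ (prec a b) c + succ (succ a b) c = succ a (succ b c)

namespace DendriformAlgebra

variable (𝕜 : Type u) [Field 𝕜]

/-- The product `a ⋆ b = a ≺ b + a ≻ b` of a dendriform algebra. -/
def star {D : Type v} [AddCommGroup D] [Module 𝕜 D] [DendriformAlgebra 𝕜 D] :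
    D →ₗ[𝕜] D →ₗ[𝕜] D :=
  prec + succ

/-- `D` is a free dendriform algebra on the generators `ι x`, `x : X`: every map from `X` to a
dendriform algebra extends uniquely to a morphism of dendriform algebras. -/
def IsFreeOn {X : Type w} {D : Type v} [AddCommGroup D] [Module 𝕜 D] [DendriformAlgebra 𝕜 D]
    (ι : X → D) : Prop :=
  ∀ (D' : Type v) [AddCommGroup D'] [Module 𝕜 D'] [DendriformAlgebra 𝕜 D'] (f : X → D'),
    ∃! g : D →ₗ[𝕜] D', (∀ a b, g (prec (𝕜 := 𝕜) a b) = prec (𝕜 := 𝕜) (g a) (g b)) ∧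
      (∀ a b, g (succ (𝕜 := 𝕜) a b) = succ (𝕜 := 𝕜) (g a) (g b)) ∧ ∀ x, g (ι x) = f x

end DendriformAlgebra

/-- The vector space `A` with the bilinear product `mul` is a free associative algebra (without
unit) on the generators `j y`, `y : Y`: the product is associative, and every map from `Y` to an
associative algebra extends uniquely to a morphism of associative algebras. -/
def IsFreeAssocOn.{z} (𝕜 : Type u) [Field 𝕜] {Y : Type w} {A : Type v} [AddCommGroup A]
    [Module 𝕜 A] (mul : A →ₗ[𝕜] A →ₗ[𝕜] A) (j : Y → A) : Prop :=
  (∀ a b c, mul (mul a b) c = mul a (mul b c)) ∧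
    ∀ (B : Type z) [NonUnitalRing B] [Module 𝕜 B] [IsScalarTower 𝕜 B B] [SMulCommClass 𝕜 B B]
      (f : Y → B), ∃! g : A →ₗ[𝕜] B, (∀ a b, g (mul a b) = g a * g b) ∧ ∀ y, g (j y) = f y

/-! ### Planar binary trees and the star product -/

/-! Both statements rest on one triangular change of basis. The free dendriform algebra on `X` has
the nonempty planar binary trees with vertices labelled by `X` as a basis. The tree with left
subtree l, root x and right subtree r stands for l ≻ x ≺ r. The operations are (l, x, r) ≺ u = (l,
x, r ⋆ u) and u ≻ (l, x, r) = (u ⋆ l, x, r), where ⋆ is defined recursively and has the empty tree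
as unit.

Cutting a tree along its leftmost branch gives a sequence of trees with empty left subtree, its
components, so trees are words in the components. `combProd` sends a tree to the star product of its
components. The result is the tree itself plus trees of the same size and smaller `rank`
(`combProd_sub_mem`), so the linear extension of `combProd` is unitriangular and therefore bijective
(`combProd_bijective`). Since it turns concatenation of words into ⋆ (`combProd_overTree`), the
nonempty trees form the free associative algebra on the trees with empty left subtree
(`FreeDend.isFreeAssocOn_star`). This is Loday–Ronco.

For the operads, evaluation at the generator of the free dendriform algebra on one generator
(`Dend.evalGen`) identifies Dend(n) with the span of the trees with n vertices. The morphism φ sends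
every tree with n leaves to the n-fold star product. Let K have the trees with empty left subtree as
a basis. Since As(k) is spanned by one element, (As ∘ K)(r) is spanned by elements indexed by a
composition of r and a component for each block, that is, by the trees with r vertices. The induced
map sends such an element to `combProd` of the corresponding tree (`Dend.incl_evalGen_inducedHom`),
so the same triangularity makes it bijective. -/

/-- Planar binary trees whose internal vertices are labelled by elements of `X`. -/
inductive DendTree (X : Type v) : Type v
  | nil : DendTree X
  | node : DendTree X → X → DendTree X → DendTree X

namespace DendTree

variable {X : Type v}

/-- The number of internal vertices. -/
def size : DendTree X → ℕ
  | nil => 0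
  | node l _ r => l.size + r.size + 1

variable (𝕜 : Type u) [Field 𝕜]

/-- The star product of two trees; the empty tree is the unit. -/
noncomputable def starTree : DendTree X → DendTree X → (DendTree X →₀ 𝕜)
  | nil, t => Finsupp.single t 1
  | node a x b, nil => Finsupp.single (node a x b) 1
  | node a x b, node c y d =>
    Finsupp.lmapDomain 𝕜 𝕜 (fun u => node a x u) (starTree b (node c y d)) +
      Finsupp.lmapDomain 𝕜 𝕜 (fun u => node u y d) (starTree (node a x b) c)
termination_by s t => s.size + t.size
decreasing_by all_goals simp only [size]; omega

/-- The bilinear extension of the star product of trees. -/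
noncomputable def star : (DendTree X →₀ 𝕜) →ₗ[𝕜] (DendTree X →₀ 𝕜) →ₗ[𝕜] (DendTree X →₀ 𝕜) :=
  Finsupp.linearCombination 𝕜 fun s => Finsupp.linearCombination 𝕜 fun t => starTree 𝕜 s t

theorem star_single (s t : DendTree X) :
    star 𝕜 (Finsupp.single s 1) (Finsupp.single t 1) = starTree 𝕜 s t := by
  simp [star]

theorem nil_star (v : DendTree X →₀ 𝕜) : star 𝕜 (Finsupp.single nil 1) v = v := by
  suffices h : star 𝕜 (Finsupp.single (nil : DendTree X) 1) = LinearMap.id from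
    LinearMap.congr_fun h v
  ext t : 2
  simp [star_single, starTree]

theorem star_nil (v : DendTree X →₀ 𝕜) : star 𝕜 v (Finsupp.single nil 1) = v := by
  suffices h : (star 𝕜).flip (Finsupp.single (nil : DendTree X) 1) = LinearMap.id from
    LinearMap.congr_fun h v
  ext t : 2
  cases t <;> simp [star_single, starTree]

end DendTree

/-- The free dendriform algebra on `X`: its basis are the nonempty planar binary trees, where the
tree with left subtree `l`, root labelled by `x` and right subtree `r` is the triple `(l, x, r)`. -/
abbrev FreeDend (𝕜 : Type u) [Field 𝕜] (X : Type v) : Type (max u v) :=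
  (DendTree X × X × DendTree X) →₀ 𝕜

namespace FreeDend

open DendTree

variable (𝕜 : Type u) [Field 𝕜] {X : Type v}

/-- The inclusion of the span of the nonempty trees into the span of all trees. -/
noncomputable def incl : FreeDend 𝕜 X →ₗ[𝕜] (DendTree X →₀ 𝕜) :=
  Finsupp.lmapDomain 𝕜 𝕜 fun n => node n.1 n.2.1 n.2.2

/-- The linear map `u ↦ (l, x, u)`. -/
noncomputable def graftRight (l : DendTree X) (x : X) : (DendTree X →₀ 𝕜) →ₗ[𝕜] FreeDend 𝕜 X :=
  Finsupp.lmapDomain 𝕜 𝕜 fun u => (l, x, u)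

/-- The linear map `u ↦ (u, x, r)`. -/
noncomputable def graftLeft (x : X) (r : DendTree X) : (DendTree X →₀ 𝕜) →ₗ[𝕜] FreeDend 𝕜 X :=
  Finsupp.lmapDomain 𝕜 𝕜 fun u => (u, x, r)

@[simp]
theorem incl_single (l : DendTree X) (x : X) (r : DendTree X) (a : 𝕜) :
    incl 𝕜 (Finsupp.single (l, x, r) a) = Finsupp.single (node l x r) a := by
  simp [incl]

@[simp]
theorem graftRight_single (l : DendTree X) (x : X) (r : DendTree X) (a : 𝕜) :
    graftRight 𝕜 l x (Finsupp.single r a) = Finsupp.single (l, x, r) a := by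
  simp [graftRight]

@[simp]
theorem graftLeft_single (l : DendTree X) (x : X) (r : DendTree X) (a : 𝕜) :
    graftLeft 𝕜 x r (Finsupp.single l a) = Finsupp.single (l, x, r) a := by
  simp [graftLeft]

/-- The operation `a ≺ u`, where `u` is a combination of possibly empty trees. -/
noncomputable def precU : FreeDend 𝕜 X →ₗ[𝕜] (DendTree X →₀ 𝕜) →ₗ[𝕜] FreeDend 𝕜 X :=
  Finsupp.linearCombination 𝕜 fun n =>
    graftRight 𝕜 n.1 n.2.1 ∘ₗ DendTree.star 𝕜 (Finsupp.single n.2.2 1)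

/-- The operation `u ≻ a`, where `u` is a combination of possibly empty trees. -/
noncomputable def succU : (DendTree X →₀ 𝕜) →ₗ[𝕜] FreeDend 𝕜 X →ₗ[𝕜] FreeDend 𝕜 X :=
  LinearMap.flip <| Finsupp.linearCombination 𝕜 fun n =>
    graftLeft 𝕜 n.2.1 n.2.2 ∘ₗ (DendTree.star 𝕜).flip (Finsupp.single n.1 1)

@[simp]
theorem precU_single (l : DendTree X) (x : X) (r : DendTree X) (u : DendTree X →₀ 𝕜) :
    precU 𝕜 (Finsupp.single (l, x, r) 1) u =
      graftRight 𝕜 l x (DendTree.star 𝕜 (Finsupp.single r 1) u) := by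
  simp [precU]

@[simp]
theorem succU_single (l : DendTree X) (x : X) (r : DendTree X) (u : DendTree X →₀ 𝕜) :
    succU 𝕜 u (Finsupp.single (l, x, r) 1) =
      graftLeft 𝕜 x r (DendTree.star 𝕜 u (Finsupp.single l 1)) := by
  simp [succU]

/-- The bilinear map `(p, q) ↦ (p, x, q)`. -/
noncomputable def join (x : X) :
    (DendTree X →₀ 𝕜) →ₗ[𝕜] (DendTree X →₀ 𝕜) →ₗ[𝕜] FreeDend 𝕜 X :=
  Finsupp.linearCombination 𝕜 fun l => graftRight 𝕜 l x

theorem precU_graftRight (l : DendTree X) (x : X) (q u : DendTree X →₀ 𝕜) :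
    precU 𝕜 (graftRight 𝕜 l x q) u = graftRight 𝕜 l x (DendTree.star 𝕜 q u) := by
  suffices h : precU 𝕜 ∘ₗ graftRight 𝕜 l x =
      (LinearMap.llcomp 𝕜 _ _ _ (graftRight 𝕜 l x)) ∘ₗ DendTree.star 𝕜 from
    LinearMap.congr_fun (LinearMap.congr_fun h q) u
  ext r t : 4
  simp

theorem succU_graftLeft (x : X) (r : DendTree X) (q u : DendTree X →₀ 𝕜) :
    succU 𝕜 u (graftLeft 𝕜 x r q) = graftLeft 𝕜 x r (DendTree.star 𝕜 u q) := by
  suffices h : succU 𝕜 u ∘ₗ graftLeft 𝕜 x r = graftLeft 𝕜 x r ∘ₗ DendTree.star 𝕜 u from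
    LinearMap.congr_fun h q
  ext l : 2
  simp

theorem precU_graftLeft (x : X) (r : DendTree X) (p u : DendTree X →₀ 𝕜) :
    precU 𝕜 (graftLeft 𝕜 x r p) u =
      join 𝕜 x p (DendTree.star 𝕜 (Finsupp.single r 1) u) := by
  suffices h : (precU 𝕜).flip u ∘ₗ graftLeft 𝕜 x r =
      (join 𝕜 x).flip (DendTree.star 𝕜 (Finsupp.single r 1) u) from LinearMap.congr_fun h p
  ext l : 2
  simp [join]

theorem succU_graftRight (l : DendTree X) (x : X) (q u : DendTree X →₀ 𝕜) :
    succU 𝕜 u (graftRight 𝕜 l x q) =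
      join 𝕜 x (DendTree.star 𝕜 u (Finsupp.single l 1)) q := by
  suffices h : succU 𝕜 u ∘ₗ graftRight 𝕜 l x =
      join 𝕜 x (DendTree.star 𝕜 u (Finsupp.single l 1)) from LinearMap.congr_fun h q
  ext r : 2
  suffices h : ∀ p : DendTree X →₀ 𝕜, graftLeft 𝕜 x r p = join 𝕜 x p (Finsupp.single r 1) by
    simp [h]
  intro p
  suffices h : graftLeft 𝕜 x r = (join 𝕜 x).flip (Finsupp.single r 1) from
    LinearMap.congr_fun h p
  ext l : 2
  simp [join]

/-- On a tree both sides equal (u ⋆ l, x, r ⋆ w), because the two operations act on different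
subtrees of the root. No associativity enters, so this is available in the proof of
`star_assoc_single`. -/
theorem precU_succU (u w : DendTree X →₀ 𝕜) (a : FreeDend 𝕜 X) :
    precU 𝕜 (succU 𝕜 u a) w = succU 𝕜 u (precU 𝕜 a w) := by
  suffices h : (precU 𝕜).flip w ∘ₗ succU 𝕜 u = succU 𝕜 u ∘ₗ (precU 𝕜).flip w from
    LinearMap.congr_fun h a
  ext ⟨l, x, r⟩ : 2
  simp [precU_graftLeft, succU_graftRight]

/-- This is the recursive clause of `starTree`, with its two summands recognised as ≺ and ≻. -/
theorem incl_precU_add_incl_succU (a b : FreeDend 𝕜 X) :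
    incl 𝕜 (precU 𝕜 a (incl 𝕜 b)) + incl 𝕜 (succU 𝕜 (incl 𝕜 a) b) =
      DendTree.star 𝕜 (incl 𝕜 a) (incl 𝕜 b) := by
  suffices h : LinearMap.compr₂ ((precU 𝕜).compl₂ (incl 𝕜)) (incl 𝕜) +
      LinearMap.compr₂ (succU 𝕜 ∘ₗ incl 𝕜) (incl 𝕜) =
      (DendTree.star 𝕜).compl₂ (incl 𝕜) ∘ₗ incl (X := X) 𝕜 from
    LinearMap.congr_fun (LinearMap.congr_fun h a) b
  ext ⟨l, x, r⟩ ⟨l', x', r'⟩ : 4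
  have h1 (q : DendTree X →₀ 𝕜) : incl 𝕜 (graftRight 𝕜 l x q) =
      Finsupp.lmapDomain 𝕜 𝕜 (fun u => node l x u) q := by
    simp [incl, graftRight, ← Finsupp.mapDomain_comp, Function.comp_def]
  have h2 (q : DendTree X →₀ 𝕜) : incl 𝕜 (graftLeft 𝕜 x' r' q) =
      Finsupp.lmapDomain 𝕜 𝕜 (fun u => node u x' r') q := by
    simp [incl, graftLeft, ← Finsupp.mapDomain_comp, Function.comp_def]
  simp [star_single, starTree, h1, h2]

end FreeDend

/-! ### Associativity of the star product -/

namespace DendTree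

open FreeDend

variable (𝕜 : Type u) [Field 𝕜] {X : Type v}

/-- Induction on the total size. For nonempty a, b, c both bracketings expand to a ≺ (b ⋆ c) + a ≻ b
≺ c + (a ⋆ b) ≻ c. The outer terms agree by associativity for the right subtree of a, respectively
the left subtree of c, and the middle one by `precU_succU`. -/
theorem star_assoc_single (s t u : DendTree X) :
    star 𝕜 (star 𝕜 (Finsupp.single s 1) (Finsupp.single t 1)) (Finsupp.single u 1) =
      star 𝕜 (Finsupp.single s 1) (star 𝕜 (Finsupp.single t 1) (Finsupp.single u (1 : 𝕜))) := by
  match s, t, u with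
  | nil, t, u => simp only [nil_star]
  | s, nil, u => simp only [nil_star, star_nil]
  | s, t, nil => simp only [star_nil]
  | node l x r, node l' x' r', node l'' x'' r'' =>
    have ih1 := star_assoc_single r (node l' x' r') (node l'' x'' r'')
    have ih2 := star_assoc_single (node l x r) (node l' x' r') l''
    have e1 := precU_graftRight 𝕜 l x (star 𝕜 (Finsupp.single r 1)
      (Finsupp.single (node l' x' r') 1)) (Finsupp.single (node l'' x'' r'') 1)
    have e2 := succU_graftLeft 𝕜 x'' r'' (star 𝕜 (Finsupp.single (node l' x' r') 1)
      (Finsupp.single l'' 1)) (Finsupp.single (node l x r) 1)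
    rw [ih1, ← precU_single, ← precU_single] at e1
    rw [← ih2, ← succU_single, ← succU_single] at e2
    -- The dendriform computation, with the two axioms supplied by the induction as hypotheses on
    -- this particular triple.
    have key : ∀ a b c : FreeDend 𝕜 X,
        precU 𝕜 (precU 𝕜 a (incl 𝕜 b)) (incl 𝕜 c) =
          precU 𝕜 a (star 𝕜 (incl 𝕜 b) (incl 𝕜 c)) →
        succU 𝕜 (incl 𝕜 a) (succU 𝕜 (incl 𝕜 b) c) =
          succU 𝕜 (star 𝕜 (incl 𝕜 a) (incl 𝕜 b)) c →
        star 𝕜 (star 𝕜 (incl 𝕜 a) (incl 𝕜 b)) (incl 𝕜 c) =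
          star 𝕜 (incl 𝕜 a) (star 𝕜 (incl 𝕜 b) (incl 𝕜 c)) := by
      intro a b c h1 h2
      rw [← incl_precU_add_incl_succU 𝕜 a b] at h2 ⊢
      rw [← incl_precU_add_incl_succU 𝕜 b c] at h1 ⊢
      simp only [map_add, LinearMap.add_apply, ← incl_precU_add_incl_succU] at h1 h2 ⊢
      rw [h1, h2, precU_succU]
      simp only [map_add]
      abel
    simpa using key (Finsupp.single (l, x, r) 1) (Finsupp.single (l', x', r') 1)
      (Finsupp.single (l'', x'', r'') 1) (by simpa using e1) (by simpa using e2)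
termination_by s.size + t.size + u.size
decreasing_by all_goals simp only [size]; omega

theorem star_assoc (p q r : DendTree X →₀ 𝕜) :
    star 𝕜 (star 𝕜 p q) r = star 𝕜 p (star 𝕜 q r) := by
  induction p using Finsupp.induction_linear with
  | zero => simp
  | add p p' hp hp' => simp only [map_add, LinearMap.add_apply, hp, hp']
  | single s a =>
  induction q using Finsupp.induction_linear with
  | zero => simp
  | add q q' hq hq' => simp only [map_add, LinearMap.add_apply, hq, hq']
  | single t b =>
  induction r using Finsupp.induction_linear with
  | zero => simp
  | add r r' hr hr' => simp only [map_add, hr, hr']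
  | single u c =>
  rw [← mul_one a, ← mul_one b, ← mul_one c, ← smul_eq_mul, ← smul_eq_mul, ← smul_eq_mul,
    ← Finsupp.smul_single, ← Finsupp.smul_single, ← Finsupp.smul_single]
  simp only [map_smul, LinearMap.smul_apply, star_assoc_single]

end DendTree

/-! ### The dendriform structure on the span of the nonempty trees -/

namespace FreeDend

open DendTree

variable (𝕜 : Type u) [Field 𝕜] {X : Type v}

theorem precU_precU (a : FreeDend 𝕜 X) (u w : DendTree X →₀ 𝕜) :
    precU 𝕜 (precU 𝕜 a u) w = precU 𝕜 a (DendTree.star 𝕜 u w) := by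
  suffices h : (precU 𝕜).flip w ∘ₗ (precU 𝕜).flip u =
      (precU 𝕜).flip (DendTree.star 𝕜 u w) from LinearMap.congr_fun h a
  ext ⟨l, x, r⟩ : 2
  simp [precU_graftRight, star_assoc]

theorem succU_succU (a : FreeDend 𝕜 X) (u w : DendTree X →₀ 𝕜) :
    succU 𝕜 u (succU 𝕜 w a) = succU 𝕜 (DendTree.star 𝕜 u w) a := by
  suffices h : succU 𝕜 u ∘ₗ succU 𝕜 w = succU 𝕜 (DendTree.star 𝕜 u w) from
    LinearMap.congr_fun h a
  ext ⟨l, x, r⟩ : 2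
  simp [succU_graftLeft, star_assoc]

noncomputable instance : DendriformAlgebra 𝕜 (FreeDend 𝕜 X) where
  prec := (precU 𝕜).compl₂ (incl 𝕜)
  succ := succU 𝕜 ∘ₗ incl 𝕜
  prec_prec a b c := by
    simp [precU_precU, ← incl_precU_add_incl_succU]
  succ_prec a b c := by
    simp [precU_succU]
  succ_succ a b c := by
    simp [succU_succU, ← incl_precU_add_incl_succU]

theorem prec_def (a b : FreeDend 𝕜 X) :
    DendriformAlgebra.prec (𝕜 := 𝕜) a b = precU 𝕜 a (incl 𝕜 b) := rfl

theorem succ_def (a b : FreeDend 𝕜 X) :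
    DendriformAlgebra.succ (𝕜 := 𝕜) a b = succU 𝕜 (incl 𝕜 a) b := rfl

theorem incl_star (a b : FreeDend 𝕜 X) :
    incl 𝕜 (DendriformAlgebra.star 𝕜 a b) = DendTree.star 𝕜 (incl 𝕜 a) (incl 𝕜 b) := by
  simp [DendriformAlgebra.star, prec_def, succ_def, incl_precU_add_incl_succU]

/-- The tree with one internal vertex. -/
noncomputable def gen (x : X) : FreeDend 𝕜 X := Finsupp.single (nil, x, nil) 1

end FreeDend

/-! ### The universal property of the algebra of trees -/

namespace DendriformAlgebra

variable (𝕜 : Type u) [Field 𝕜] {D : Type w} [AddCommGroup D] [Module 𝕜 D]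
  [DendriformAlgebra 𝕜 D]

/-- The operation `a ≺ (c + d) = c • a + a ≺ d`, where `c` is a scalar. -/
noncomputable def precUnit : D →ₗ[𝕜] 𝕜 × D →ₗ[𝕜] D :=
  (LinearMap.lsmul 𝕜 D).flip.compl₂ (LinearMap.fst 𝕜 𝕜 D) +
    (prec (𝕜 := 𝕜) (D := D)).compl₂ (LinearMap.snd 𝕜 𝕜 D)

/-- The operation `(c + d) ≻ a = c • a + d ≻ a`, where `c` is a scalar. -/
noncomputable def succUnit : 𝕜 × D →ₗ[𝕜] D →ₗ[𝕜] D :=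
  LinearMap.lsmul 𝕜 D ∘ₗ LinearMap.fst 𝕜 𝕜 D + succ (𝕜 := 𝕜) (D := D) ∘ₗ LinearMap.snd 𝕜 𝕜 D

/-- The star product with an adjoined unit. -/
noncomputable def starUnit (u v : 𝕜 × D) : 𝕜 × D :=
  (u.1 * v.1, u.1 • v.2 + v.1 • u.2 + star 𝕜 u.2 v.2)

theorem precUnit_apply (a : D) (u : 𝕜 × D) :
    precUnit 𝕜 a u = u.1 • a + prec (𝕜 := 𝕜) a u.2 := rfl

theorem succUnit_apply (u : 𝕜 × D) (a : D) :
    succUnit 𝕜 u a = u.1 • a + succ (𝕜 := 𝕜) u.2 a := rfl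

/-- The dendriform axioms survive the adjunction of a unit as long as `a` stays in `D`: ill-defined
expressions such as 1 ≺ 1 are never formed. -/
theorem precUnit_precUnit (a : D) (u v : 𝕜 × D) :
    precUnit 𝕜 (precUnit 𝕜 a u) v = precUnit 𝕜 a (starUnit 𝕜 u v) := by
  simp only [precUnit_apply, starUnit, star, map_add, map_smul, LinearMap.add_apply,
    LinearMap.smul_apply, prec_prec]
  module

theorem succUnit_succUnit (a : D) (u v : 𝕜 × D) :
    succUnit 𝕜 u (succUnit 𝕜 v a) = succUnit 𝕜 (starUnit 𝕜 u v) a := by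
  simp only [succUnit_apply, starUnit, star, map_add, map_smul, LinearMap.add_apply,
    LinearMap.smul_apply, ← succ_succ]
  module

theorem precUnit_succUnit (a : D) (u v : 𝕜 × D) :
    precUnit 𝕜 (succUnit 𝕜 u a) v = succUnit 𝕜 u (precUnit 𝕜 a v) := by
  simp only [precUnit_apply, succUnit_apply, map_add, map_smul, LinearMap.add_apply,
    LinearMap.smul_apply, ← succ_prec]
  module

theorem starUnit_zero_zero (a b : D) :
    starUnit 𝕜 (0, a) (0, b) = (0, precUnit 𝕜 a (0, b) + succUnit 𝕜 (0, a) b) := by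
  simp [starUnit, precUnit_apply, succUnit_apply, star]

theorem starUnit_one_left (u : 𝕜 × D) : starUnit 𝕜 (1, 0) u = u := by
  simp [starUnit]

theorem starUnit_one_right (u : 𝕜 × D) : starUnit 𝕜 u (1, 0) = u := by
  simp [starUnit]

theorem star_assoc (a b c : D) : star 𝕜 (star 𝕜 a b) c = star 𝕜 a (star 𝕜 b c) := by
  simp only [star, LinearMap.add_apply, map_add, prec_prec, succ_prec, ← succ_succ]
  abel

end DendriformAlgebra

namespace FreeDend

open DendTree DendriformAlgebra

variable (𝕜 : Type u) [Field 𝕜] {X : Type v} {D : Type w} [AddCommGroup D] [Module 𝕜 D]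
  [DendriformAlgebra 𝕜 D] (f : X → D)

/-- The value of a tree in a dendriform algebra, the empty tree being sent to an adjoined unit. -/
noncomputable def liftTree : DendTree X → 𝕜 × D
  | nil => (1, 0)
  | node l x r => (0, succUnit 𝕜 (liftTree l) (precUnit 𝕜 (f x) (liftTree r)))

/-- The linear extension of `liftTree`. -/
noncomputable def liftUnit : (DendTree X →₀ 𝕜) →ₗ[𝕜] 𝕜 × D :=
  Finsupp.linearCombination 𝕜 (liftTree 𝕜 f)

/-- The morphism from the algebra of trees to a dendriform algebra with prescribed values on
generators. -/
noncomputable def lift : FreeDend 𝕜 X →ₗ[𝕜] D :=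
  LinearMap.snd 𝕜 𝕜 D ∘ₗ liftUnit 𝕜 f ∘ₗ incl 𝕜

theorem liftUnit_incl (a : FreeDend 𝕜 X) : liftUnit 𝕜 f (incl 𝕜 a) = (0, lift 𝕜 f a) := by
  refine Prod.ext ?_ rfl
  suffices h : LinearMap.fst 𝕜 𝕜 D ∘ₗ liftUnit 𝕜 f ∘ₗ incl 𝕜 = 0 from LinearMap.congr_fun h a
  ext ⟨l, x, r⟩ : 2
  simp [liftUnit, liftTree]

theorem lift_graftRight (l : DendTree X) (x : X) (q : DendTree X →₀ 𝕜) :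
    lift 𝕜 f (graftRight 𝕜 l x q) =
      succUnit 𝕜 (liftTree 𝕜 f l) (precUnit 𝕜 (f x) (liftUnit 𝕜 f q)) := by
  suffices h : lift 𝕜 f ∘ₗ graftRight 𝕜 l x =
      succUnit 𝕜 (liftTree 𝕜 f l) ∘ₗ precUnit 𝕜 (f x) ∘ₗ liftUnit 𝕜 f from
    LinearMap.congr_fun h q
  ext r : 2
  simp [lift, liftUnit, liftTree]

theorem lift_graftLeft (x : X) (r : DendTree X) (q : DendTree X →₀ 𝕜) :
    lift 𝕜 f (graftLeft 𝕜 x r q) =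
      succUnit 𝕜 (liftUnit 𝕜 f q) (precUnit 𝕜 (f x) (liftTree 𝕜 f r)) := by
  suffices h : lift 𝕜 f ∘ₗ graftLeft 𝕜 x r =
      (succUnit 𝕜).flip (precUnit 𝕜 (f x) (liftTree 𝕜 f r)) ∘ₗ liftUnit 𝕜 f from
    LinearMap.congr_fun h q
  ext l : 2
  simp [lift, liftUnit, liftTree]

theorem liftUnit_single (t : DendTree X) :
    liftUnit 𝕜 f (Finsupp.single t 1) = liftTree 𝕜 f t := by
  simp [liftUnit]

/-- Induction on the total size along the recursion of `starTree`. The two summands are handled by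
the unital forms of the axioms for ≺ and ≻. -/
theorem liftUnit_star_single (s t : DendTree X) :
    liftUnit 𝕜 f (DendTree.star 𝕜 (Finsupp.single s 1) (Finsupp.single t 1)) =
      starUnit 𝕜 (liftTree 𝕜 f s) (liftTree 𝕜 f t) := by
  match s, t with
  | nil, t => simp only [nil_star, liftTree, starUnit_one_left, liftUnit_single]
  | s, nil => simp only [star_nil, liftTree, starUnit_one_right, liftUnit_single]
  | node l x r, node l' x' r' =>
    have ih1 := liftUnit_star_single r (node l' x' r')
    have ih2 := liftUnit_star_single (node l x r) l'
    have e := incl_precU_add_incl_succU 𝕜 (Finsupp.single (l, x, r) 1)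
      (Finsupp.single (l', x', r') (1 : 𝕜))
    simp only [incl_single] at e
    rw [← e, map_add, liftUnit_incl, liftUnit_incl, precU_single, succU_single, lift_graftRight,
      lift_graftLeft, ih1, ih2]
    simp only [liftTree]
    rw [starUnit_zero_zero, precUnit_succUnit, precUnit_precUnit, succUnit_succUnit]
    simp
termination_by s.size + t.size
decreasing_by all_goals simp only [size]; omega

theorem lift_precU_single (a : FreeDend 𝕜 X) (t : DendTree X) :
    lift 𝕜 f (precU 𝕜 a (Finsupp.single t 1)) =
      precUnit 𝕜 (lift 𝕜 f a) (liftTree 𝕜 f t) := by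
  suffices h : lift 𝕜 f ∘ₗ (precU 𝕜).flip (Finsupp.single t 1) =
      (precUnit 𝕜).flip (liftTree 𝕜 f t) ∘ₗ lift 𝕜 f from LinearMap.congr_fun h a
  ext ⟨l, x, r⟩ : 2
  have h := lift_graftRight 𝕜 f l x (Finsupp.single r 1)
  rw [graftRight_single] at h
  simp [lift_graftRight, liftUnit_star_single, h, liftUnit_single, precUnit_succUnit,
    precUnit_precUnit]

theorem lift_succU_single (a : FreeDend 𝕜 X) (t : DendTree X) :
    lift 𝕜 f (succU 𝕜 (Finsupp.single t 1) a) =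
      succUnit 𝕜 (liftTree 𝕜 f t) (lift 𝕜 f a) := by
  suffices h : lift 𝕜 f ∘ₗ succU 𝕜 (Finsupp.single t 1) =
      succUnit 𝕜 (liftTree 𝕜 f t) ∘ₗ lift 𝕜 f from LinearMap.congr_fun h a
  ext ⟨l, x, r⟩ : 2
  have h := lift_graftLeft 𝕜 f x r (Finsupp.single l 1)
  rw [graftLeft_single] at h
  simp [lift_graftLeft, liftUnit_star_single, h, liftUnit_single, succUnit_succUnit]

theorem lift_prec (a b : FreeDend 𝕜 X) :
    lift 𝕜 f (prec (𝕜 := 𝕜) a b) = prec (𝕜 := 𝕜) (lift 𝕜 f a) (lift 𝕜 f b) := by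
  have h : lift 𝕜 f ∘ₗ precU 𝕜 a = precUnit 𝕜 (lift 𝕜 f a) ∘ₗ liftUnit 𝕜 f := by
    ext t : 2
    simp [lift_precU_single, liftUnit_single]
  have h' := LinearMap.congr_fun h (incl 𝕜 b)
  simpa [prec_def, liftUnit_incl, precUnit_apply] using h'

theorem lift_succ (a b : FreeDend 𝕜 X) :
    lift 𝕜 f (succ (𝕜 := 𝕜) a b) = succ (𝕜 := 𝕜) (lift 𝕜 f a) (lift 𝕜 f b) := by
  have h : lift 𝕜 f ∘ₗ (succU 𝕜).flip b = (succUnit 𝕜).flip (lift 𝕜 f b) ∘ₗ liftUnit 𝕜 f := by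
    ext t : 2
    simp [lift_succU_single, liftUnit_single]
  have h' := LinearMap.congr_fun h (incl 𝕜 a)
  simpa [succ_def, liftUnit_incl, succUnit_apply] using h'

theorem lift_gen (x : X) : lift 𝕜 f (gen 𝕜 x) = f x := by
  simp [lift, gen, liftUnit, liftTree, precUnit_apply, succUnit_apply]

theorem single_eq_succU_precU (l : DendTree X) (x : X) (r : DendTree X) :
    (Finsupp.single (l, x, r) 1 : FreeDend 𝕜 X) =
      succU 𝕜 (Finsupp.single l 1) (precU 𝕜 (gen 𝕜 x) (Finsupp.single r 1)) := by
  rw [gen, precU_single, nil_star, graftRight_single, succU_single, star_nil, graftLeft_single]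

theorem precU_nil (a : FreeDend 𝕜 X) : precU 𝕜 a (Finsupp.single nil 1) = a := by
  suffices h : (precU 𝕜).flip (Finsupp.single nil 1) = LinearMap.id (M := FreeDend 𝕜 X) from
    LinearMap.congr_fun h a
  ext ⟨l, x, r⟩ : 2
  simp [star_nil]

theorem succU_nil (a : FreeDend 𝕜 X) : succU 𝕜 (Finsupp.single nil 1) a = a := by
  suffices h : succU 𝕜 (Finsupp.single nil 1) = LinearMap.id (M := FreeDend 𝕜 X) from
    LinearMap.congr_fun h a
  ext ⟨l, x, r⟩ : 2
  simp [nil_star]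

/-- Two morphisms of dendriform algebras that agree on the generators are equal. -/
theorem hom_ext {g g' : FreeDend 𝕜 X →ₗ[𝕜] D}
    (hp : ∀ a b, g (prec (𝕜 := 𝕜) a b) = prec (𝕜 := 𝕜) (g a) (g b))
    (hs : ∀ a b, g (succ (𝕜 := 𝕜) a b) = succ (𝕜 := 𝕜) (g a) (g b))
    (hp' : ∀ a b, g' (prec (𝕜 := 𝕜) a b) = prec (𝕜 := 𝕜) (g' a) (g' b))
    (hs' : ∀ a b, g' (succ (𝕜 := 𝕜) a b) = succ (𝕜 := 𝕜) (g' a) (g' b))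
    (h : ∀ x, g (gen 𝕜 x) = g' (gen 𝕜 x)) : g = g' := by
  -- The induction runs over trees, although the basis consists of triples: a triple is l ≻ (x ≺ r),
  -- and an empty l or r is absorbed by the unit.
  have key : ∀ t : DendTree X, ∀ l x r, t = node l x r →
      g (Finsupp.single (l, x, r) 1) = g' (Finsupp.single (l, x, r) 1) := by
    intro t
    induction t with
    | nil => intro l x r h; cases h
    | node l x r ihl ihr =>
      rintro _ _ _ ⟨⟩
      have e1 : g (precU 𝕜 (gen 𝕜 x) (Finsupp.single r 1)) =
          g' (precU 𝕜 (gen 𝕜 x) (Finsupp.single r 1)) := by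
        cases r with
        | nil => simp only [precU_nil, h]
        | node a y b =>
          rw [← incl_single, ← prec_def, hp, hp', h, ihr _ _ _ rfl]
      rw [single_eq_succU_precU]
      cases l with
      | nil => simp only [succU_nil, e1]
      | node a y b => rw [← incl_single, ← succ_def, hs, hs', e1, ihl _ _ _ rfl]
  ext ⟨l, x, r⟩ : 2
  exact key _ l x r rfl

end FreeDend

/-- A free dendriform algebra is isomorphic to the algebra of trees. -/
theorem DendriformAlgebra.IsFreeOn.exists_equiv {𝕜 : Type u} [Field 𝕜] {X : Type v}
    {D : Type (max u v)} [AddCommGroup D] [Module 𝕜 D] [DendriformAlgebra 𝕜 D] {ι : X → D}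
    (h : IsFreeOn 𝕜 ι) :
    ∃ e : FreeDend 𝕜 X ≃ₗ[𝕜] D, ∀ a b, e (star 𝕜 a b) = star 𝕜 (e a) (e b) := by
  -- The tree algebra lives in the universe of `D`, so it is an admissible target for the universal
  -- property.
  obtain ⟨g, ⟨hp, hs, hg⟩, -⟩ := h (FreeDend 𝕜 X) (FreeDend.gen 𝕜)
  refine ⟨LinearEquiv.ofLinearMap (FreeDend.lift 𝕜 ι) g ?_ ?_, fun a b => ?_⟩
  · refine (h D ι).unique ⟨fun a b => ?_, fun a b => ?_, fun x => ?_⟩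
      ⟨fun _ _ => rfl, fun _ _ => rfl, fun _ => rfl⟩
    · simp only [LinearMap.comp_apply, hp, FreeDend.lift_prec]
    · simp only [LinearMap.comp_apply, hs, FreeDend.lift_succ]
    · simp only [LinearMap.comp_apply, hg, FreeDend.lift_gen]
  · refine FreeDend.hom_ext 𝕜 (fun a b => ?_) (fun a b => ?_) (fun _ _ => rfl) (fun _ _ => rfl)
      fun x => ?_
    · simp only [LinearMap.comp_apply, hp, FreeDend.lift_prec]
    · simp only [LinearMap.comp_apply, hs, FreeDend.lift_succ]
    · simp only [LinearMap.comp_apply, hg, FreeDend.lift_gen, LinearMap.id_apply]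
  · simp [star, FreeDend.lift_prec, FreeDend.lift_succ]

/-! ### The star product is free -/

/-- A linear endomorphism of a free module which is unitriangular with respect to a rank and
homogeneous with respect to a size maps the part of each size onto itself. -/
theorem Finsupp.single_mem_map_of_triangular {𝕜 : Type u} [Field 𝕜] {T : Type v} (sz rk : T → ℕ)
    (f : (T →₀ 𝕜) →ₗ[𝕜] (T →₀ 𝕜))
    (hf : ∀ t, f (Finsupp.single t 1) - Finsupp.single t 1 ∈
      Finsupp.supported 𝕜 𝕜 {s | sz s = sz t ∧ rk s < rk t}) (t : T) :
    Finsupp.single t 1 ∈ (Finsupp.supported 𝕜 𝕜 {s | sz s = sz t}).map f := by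
  induction h : rk t using Nat.strong_induction_on generalizing t with
  | _ n ih =>
  subst h
  have h1 : Finsupp.supported 𝕜 𝕜 {s | sz s = sz t ∧ rk s < rk t} ≤
      (Finsupp.supported 𝕜 𝕜 {s | sz s = sz t}).map f := by
    rw [Finsupp.supported_eq_span_single, Submodule.span_le]
    rintro _ ⟨s, ⟨hs, hs'⟩, rfl⟩
    have := ih _ hs' s rfl
    rwa [hs] at this
  -- The basis vector is its image minus a combination of basis vectors of smaller rank, which lie
  -- in the image by induction.
  rw [← sub_sub_cancel (f (Finsupp.single t 1)) (Finsupp.single t 1)]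
  exact Submodule.sub_mem _
    (Submodule.mem_map_of_mem (Finsupp.single_mem_supported 𝕜 _ (by simp))) (h1 (hf t))

/-- A unitriangular linear endomorphism of a free module is bijective. -/
theorem Finsupp.bijective_of_triangular {𝕜 : Type u} [Field 𝕜] {T : Type v} (sz rk : T → ℕ)
    (f : (T →₀ 𝕜) →ₗ[𝕜] (T →₀ 𝕜))
    (hf : ∀ t, f (Finsupp.single t 1) - Finsupp.single t 1 ∈
      Finsupp.supported 𝕜 𝕜 {s | sz s = sz t ∧ rk s < rk t}) : Function.Bijective f := by
  constructor
  · rw [injective_iff_map_eq_zero]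
    intro v hv
    by_contra hne
    -- At an element of maximal rank in the support no correction term contributes, so the
    -- coefficient of `f v` there is that of `v`.
    obtain ⟨t, ht, hmax⟩ := v.support.exists_max_image rk (Finsupp.support_nonempty_iff.2 hne)
    have h1 : f v - v = v.sum fun s a => a • (f (Finsupp.single s 1) - Finsupp.single s 1) := by
      have : f - LinearMap.id = Finsupp.linearCombination 𝕜
          fun s => f (Finsupp.single s 1) - Finsupp.single s 1 := by
        ext s : 2
        simp
      simpa [Finsupp.linearCombination_apply] using LinearMap.congr_fun this v
    have h2 : (f v - v) t = 0 := by
      rw [h1, Finsupp.sum, Finsupp.finsetSum_apply]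
      refine Finset.sum_eq_zero fun s hs => ?_
      rw [Finsupp.smul_apply]
      have h3 := (Finsupp.mem_supported' 𝕜 _).1 (hf s) t fun h => (hmax s hs).not_gt h.2
      rw [h3, smul_zero]
    rw [hv, zero_sub, Finsupp.neg_apply, neg_eq_zero] at h2
    exact (Finsupp.mem_support_iff.1 ht) h2
  · rw [← LinearMap.range_eq_top, eq_top_iff, ← Finsupp.span_single_eq_top, Submodule.span_le]
    rintro _ ⟨t, c, rfl⟩
    obtain ⟨v, -, hv⟩ := Finsupp.single_mem_map_of_triangular sz rk f hf t
    exact ⟨c • v, by rw [map_smul, hv, Finsupp.smul_single, smul_eq_mul, mul_one]⟩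

/-! ### Triangularity of the products of components -/

namespace DendTree

open FreeDend

variable (𝕜 : Type u) [Field 𝕜] {X : Type v}

/-- A rank that compares trees according to the sizes of their iterated left subtrees. -/
def rank : DendTree X → ℕ
  | nil => 0
  | node l _ _ => 2 ^ l.size + l.rank

/-- The rank is a binary numeral: its nonzero digits stand at the sizes of the iterated left
subtrees, which are distinct and smaller than the size of the tree. -/
theorem rank_lt (t : DendTree X) : t.rank < 2 ^ t.size := by
  induction t with
  | nil => simp [rank, size]
  | node l x r ihl _ =>
    calc 2 ^ l.size + l.rank < 2 ^ l.size + 2 ^ l.size := by omega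
      _ = 2 ^ (l.size + 1) := by ring
      _ ≤ 2 ^ (l.size + r.size + 1) := Nat.pow_le_pow_right (by norm_num) (by omega)

theorem starTree_mem_supported (s t : DendTree X) :
    starTree 𝕜 s t ∈ Finsupp.supported 𝕜 𝕜 {u | u.size = s.size + t.size} := by
  match s, t with
  | nil, t =>
    rw [starTree]
    exact Finsupp.single_mem_supported 𝕜 _ (by simp [size])
  | node l x r, nil =>
    rw [starTree]
    exact Finsupp.single_mem_supported 𝕜 _ (by simp [size])
  | node l x r, node l' x' r' =>
    rw [starTree]
    have ih1 := starTree_mem_supported r (node l' x' r')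
    have ih2 := starTree_mem_supported (node l x r) l'
    refine add_mem ?_ ?_
    · have := Submodule.mem_map_of_mem (f := Finsupp.lmapDomain 𝕜 𝕜 fun u => node l x u) ih1
      rw [Finsupp.lmapDomain_supported] at this
      refine Finsupp.supported_mono ?_ this
      rintro _ ⟨u, hu, rfl⟩
      simp only [Set.mem_ofPred_eq, size] at hu ⊢
      omega
    · have := Submodule.mem_map_of_mem (f := Finsupp.lmapDomain 𝕜 𝕜 fun u => node u x' r') ih2
      rw [Finsupp.lmapDomain_supported] at this
      refine Finsupp.supported_mono ?_ this
      rintro _ ⟨u, hu, rfl⟩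
      simp only [Set.mem_ofPred_eq, size] at hu ⊢
      omega
termination_by s.size + t.size
decreasing_by all_goals simp only [size]; omega

/-- In the recursion for ⋆ one summand is exactly `node s x r`, since the right-hand factor has an
empty left subtree. In every other term the left subtree of the root is that of `s`, hence smaller
than `s`. The bound `2 ^ s.size` is the leading digit of the rank of `node s x r`. -/
theorem star_node_nil_sub_mem (s : DendTree X) (x : X) (r : DendTree X) :
    star 𝕜 (Finsupp.single s 1) (Finsupp.single (node nil x r) 1) - Finsupp.single (node s x r) 1 ∈
      Finsupp.supported 𝕜 𝕜 {u | u.size = (node s x r).size ∧ u.rank < 2 ^ s.size} := by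
  cases s with
  | nil => simp [nil_star]
  | node a y b =>
    rw [star_single, starTree, starTree, Finsupp.lmapDomain_apply, Finsupp.lmapDomain_apply,
      Finsupp.mapDomain_single, add_sub_cancel_right]
    have := Submodule.mem_map_of_mem (f := Finsupp.lmapDomain 𝕜 𝕜 fun u => node a y u)
      (starTree_mem_supported 𝕜 b (node nil x r))
    rw [Finsupp.lmapDomain_supported] at this
    refine Finsupp.supported_mono ?_ this
    rintro _ ⟨u, hu, rfl⟩
    simp only [Set.mem_ofPred_eq, size] at hu ⊢
    -- The rank ignores the right subtree, so it may be bounded on the tree with right subtree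
    -- `nil`.
    refine ⟨by omega, lt_of_lt_of_le (rank_lt (node a y nil)) ?_⟩
    simp only [size]
    exact Nat.pow_le_pow_right (by norm_num) (by omega)

/-- The star product of the trees with empty left subtree into which a tree decomposes along its
leftmost branch. -/
noncomputable def combProd : DendTree X → (DendTree X →₀ 𝕜)
  | nil => Finsupp.single nil 1
  | node l x r => star 𝕜 (combProd l) (Finsupp.single (node nil x r) 1)

/-- Multiplying by the last component preserves the order: trees `s` of the same size as `l` give
the same leading digit, and the remaining digits compare `s` with `l`. The other terms lack this
leading digit. -/
theorem combProd_sub_mem (t : DendTree X) :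
    combProd 𝕜 t - Finsupp.single t 1 ∈
      Finsupp.supported 𝕜 𝕜 {s | s.size = t.size ∧ s.rank < t.rank} := by
  induction t with
  | nil => simp [combProd]
  | node l x r ihl _ =>
    have h1 : star 𝕜 (combProd 𝕜 l - Finsupp.single l 1) (Finsupp.single (node nil x r) 1) ∈
        Finsupp.supported 𝕜 𝕜 {s | s.size = (node l x r).size ∧ s.rank < (node l x r).rank} := by
      have : Finsupp.supported 𝕜 𝕜 {s | s.size = l.size ∧ s.rank < l.rank} ≤
          (Finsupp.supported 𝕜 𝕜
            {s | s.size = (node l x r).size ∧ s.rank < (node l x r).rank}).comap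
              ((star 𝕜).flip (Finsupp.single (node nil x r) 1)) := by
        rw [Finsupp.supported_eq_span_single, Submodule.span_le]
        rintro _ ⟨s, ⟨hs, hs'⟩, rfl⟩
        -- The product with `s` is split into its leading tree `node s x r` and the lower terms.
        rw [SetLike.mem_coe, Submodule.mem_comap, LinearMap.flip_apply,
          ← sub_add_cancel (star 𝕜 _ _) (Finsupp.single (node s x r) 1)]
        refine add_mem (Finsupp.supported_mono ?_ (star_node_nil_sub_mem 𝕜 s x r))
          (Finsupp.single_mem_supported 𝕜 _ ?_)
        · rintro u ⟨hu, hu'⟩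
          rw [hs] at hu'
          simp only [Set.mem_ofPred_eq, size, rank] at hu ⊢
          omega
        · simp only [Set.mem_ofPred_eq, size, rank, hs]
          exact ⟨trivial, by omega⟩
      exact this ihl
    have h2 := star_node_nil_sub_mem 𝕜 l x r
    have h3 : combProd 𝕜 (node l x r) - Finsupp.single (node l x r) 1 =
        star 𝕜 (combProd 𝕜 l - Finsupp.single l 1) (Finsupp.single (node nil x r) 1) +
        (star 𝕜 (Finsupp.single l 1) (Finsupp.single (node nil x r) 1) -
          Finsupp.single (node l x r) 1) := by
      simp [combProd]
    rw [h3]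
    refine add_mem h1 (Finsupp.supported_mono ?_ h2)
    rintro u ⟨hu, hu'⟩
    simp only [Set.mem_ofPred_eq, rank] at hu ⊢
    exact ⟨hu, by omega⟩

theorem combProd_mem_supported (t : DendTree X) :
    combProd 𝕜 t ∈ Finsupp.supported 𝕜 𝕜 {s | s.size = t.size} := by
  rw [← sub_add_cancel (combProd 𝕜 t) (Finsupp.single t 1)]
  exact add_mem (Finsupp.supported_mono (fun _ h => h.1) (combProd_sub_mem 𝕜 t))
    (Finsupp.single_mem_supported 𝕜 _ rfl)

theorem combProd_bijective : Function.Bijective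
    (Finsupp.linearCombination 𝕜 (combProd 𝕜 : DendTree X → (DendTree X →₀ 𝕜))) :=
  Finsupp.bijective_of_triangular size rank _ fun t => by
    simpa using combProd_sub_mem 𝕜 t

theorem single_mem_span_combProd (t : DendTree X) :
    (Finsupp.single t 1 : DendTree X →₀ 𝕜) ∈
      Submodule.span 𝕜 (combProd 𝕜 '' {s | s.size = t.size}) := by
  have h := Finsupp.single_mem_map_of_triangular (𝕜 := 𝕜) size rank
    (Finsupp.linearCombination 𝕜 (combProd 𝕜 : DendTree X → (DendTree X →₀ 𝕜)))
    (fun t => by simpa using combProd_sub_mem 𝕜 t) t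
  rwa [Finsupp.span_image_eq_map_linearCombination]

/-- The linear automorphism that sends each tree to the star product of its components. -/
noncomputable def combEquiv : (DendTree X →₀ 𝕜) ≃ₗ[𝕜] (DendTree X →₀ 𝕜) :=
  LinearEquiv.ofBijective _ (combProd_bijective 𝕜)

theorem combEquiv_single (t : DendTree X) :
    combEquiv 𝕜 (Finsupp.single t 1) = combProd 𝕜 t := by
  simp [combEquiv]

/-- The tree obtained by grafting `s` at the leftmost leaf of a tree. -/
def overTree (s : DendTree X) : DendTree X → DendTree X
  | nil => s
  | node l x r => node (overTree s l) x r

/-- Grafting at the leftmost leaf concatenates the sequences of components. -/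
theorem combProd_overTree (s t : DendTree X) :
    combProd 𝕜 (overTree s t) = star 𝕜 (combProd 𝕜 s) (combProd 𝕜 t) := by
  induction t with
  | nil => simp [overTree, combProd, star_nil]
  | node l x r ihl _ => simp only [overTree, combProd, ihl, star_assoc]

/-! ### Extension of maps from the components to an associative algebra -/

section Lift

variable {B : Type w} [NonUnitalRing B] [Module 𝕜 B] [IsScalarTower 𝕜 B B] [SMulCommClass 𝕜 B B]
  (f : X × DendTree X → B)

/-- The product of the values of the components of a tree, in the unitization of an algebra. -/
noncomputable def assocTree : DendTree X → Unitization 𝕜 B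
  | nil => 1
  | node l x r => assocTree l * Unitization.inr (f (x, r))

theorem assocTree_overTree (s t : DendTree X) :
    assocTree 𝕜 f (overTree s t) = assocTree 𝕜 f s * assocTree 𝕜 f t := by
  induction t with
  | nil => simp [overTree, assocTree]
  | node l x r ihl _ => simp only [overTree, assocTree, ihl, mul_assoc]

/-- The linear map that sends the product of the components of a tree to the product of their
values. -/
noncomputable def assocLift : (DendTree X →₀ 𝕜) →ₗ[𝕜] Unitization 𝕜 B :=
  Finsupp.linearCombination 𝕜 (assocTree 𝕜 f) ∘ₗ (combEquiv 𝕜).symm.toLinearMap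

omit [IsScalarTower 𝕜 B B] [SMulCommClass 𝕜 B B] in
theorem assocLift_combProd (t : DendTree X) :
    assocLift 𝕜 f (combProd 𝕜 t) = assocTree 𝕜 f t := by
  simp [assocLift, ← combEquiv_single]

/-- In the basis `combProd` the star product is concatenation of words, for which multiplicativity
is `assocTree_overTree`. -/
theorem assocLift_star (p q : DendTree X →₀ 𝕜) :
    assocLift 𝕜 f (star 𝕜 p q) = assocLift 𝕜 f p * assocLift 𝕜 f q := by
  obtain ⟨p, rfl⟩ := (combEquiv 𝕜).surjective p
  obtain ⟨q, rfl⟩ := (combEquiv 𝕜).surjective q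
  suffices h : ((star 𝕜).compl₂ (combEquiv 𝕜).toLinearMap ∘ₗ
      (combEquiv (X := X) 𝕜).toLinearMap).compr₂ (assocLift 𝕜 f) =
      ((LinearMap.mul 𝕜 (Unitization 𝕜 B)).compl₂ (assocLift 𝕜 f ∘ₗ (combEquiv 𝕜).toLinearMap)) ∘ₗ
        (assocLift 𝕜 f ∘ₗ (combEquiv 𝕜).toLinearMap) from
    LinearMap.congr_fun (LinearMap.congr_fun h p) q
  refine Finsupp.lhom_ext' fun s => LinearMap.ext_ring (Finsupp.lhom_ext' fun t =>
    LinearMap.ext_ring ?_)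
  simp [combEquiv_single, ← combProd_overTree, assocLift_combProd, assocTree_overTree]

theorem combProd_apply_nil (t : DendTree X) :
    combProd 𝕜 t nil = (Finsupp.single t (1 : 𝕜) : DendTree X →₀ 𝕜) nil := by
  cases t with
  | nil => simp [combProd]
  | node l x r =>
    rw [(Finsupp.mem_supported' 𝕜 _).1 (combProd_mem_supported 𝕜 (node l x r)) nil
      (by simp [size])]
    simp

/-- Only the empty word has a scalar part. Hence combinations of nonempty trees are sent into `B`
itself, which makes the lift non-unital. -/
theorem fst_assocLift (p : DendTree X →₀ 𝕜) : (assocLift 𝕜 f p).fst = p nil := by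
  obtain ⟨p, rfl⟩ := (combEquiv 𝕜).surjective p
  suffices h : (Unitization.fstHom 𝕜 B).toLinearMap ∘ₗ assocLift 𝕜 f ∘ₗ (combEquiv 𝕜).toLinearMap =
      Finsupp.lapply nil ∘ₗ (combEquiv 𝕜).toLinearMap from LinearMap.congr_fun h p
  refine Finsupp.lhom_ext' fun t => LinearMap.ext_ring ?_
  simp only [LinearMap.comp_apply, LinearEquiv.coe_coe, Finsupp.lsingle_apply, combEquiv_single,
    assocLift_combProd, Finsupp.lapply_apply, combProd_apply_nil]
  cases t <;> simp [assocTree]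

end Lift

end DendTree

/-! ### The universal property of the star product on nonempty trees -/

namespace FreeDend

open DendTree DendriformAlgebra

variable (𝕜 : Type u) [Field 𝕜] {X : Type v}

/-- The projection from the span of all trees to the span of the nonempty trees. -/
noncomputable def proj : (DendTree X →₀ 𝕜) →ₗ[𝕜] FreeDend 𝕜 X :=
  Finsupp.linearCombination 𝕜 fun t => match t with
    | nil => 0
    | node l x r => Finsupp.single (l, x, r) 1

theorem proj_incl (a : FreeDend 𝕜 X) : proj 𝕜 (incl 𝕜 a) = a := by
  suffices h : proj 𝕜 ∘ₗ incl 𝕜 = LinearMap.id (M := FreeDend 𝕜 X) from LinearMap.congr_fun h a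
  ext ⟨l, x, r⟩ : 2
  simp [proj]

theorem incl_injective : Function.Injective (incl (X := X) 𝕜) :=
  Function.LeftInverse.injective (proj_incl 𝕜)

theorem incl_proj (p : DendTree X →₀ 𝕜) (hp : p nil = 0) : incl 𝕜 (proj 𝕜 p) = p := by
  suffices h : incl 𝕜 ∘ₗ proj 𝕜 + Finsupp.lsingle nil ∘ₗ Finsupp.lapply nil =
      LinearMap.id (M := DendTree X →₀ 𝕜) by
    simpa [hp] using LinearMap.congr_fun h p
  refine Finsupp.lhom_ext' fun t => LinearMap.ext_ring ?_
  cases t <;> simp [proj]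

theorem incl_apply_nil (a : FreeDend 𝕜 X) : incl 𝕜 a nil = 0 := by
  suffices h : Finsupp.lapply nil ∘ₗ incl 𝕜 = (0 : FreeDend 𝕜 X →ₗ[𝕜] 𝕜) from
    LinearMap.congr_fun h a
  ext ⟨l, x, r⟩ : 2
  simp

/-- The star product of the algebra of trees is free, on the trees with empty left subtree. -/
theorem isFreeAssocOn_star : IsFreeAssocOn.{u, max u v, v, w} 𝕜 (star 𝕜 (D := FreeDend 𝕜 X))
    (fun y : X × DendTree X => Finsupp.single (nil, y.1, y.2) 1) := by
  refine ⟨DendriformAlgebra.star_assoc 𝕜, ?_⟩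
  intro B _ _ _ _ f
  -- The cross terms in the product of the unitization vanish because both scalar parts are zero.
  have hmul : ∀ a b : FreeDend 𝕜 X, (assocLift 𝕜 f (incl 𝕜 (star 𝕜 a b))).snd =
      (assocLift 𝕜 f (incl 𝕜 a)).snd * (assocLift 𝕜 f (incl 𝕜 b)).snd := by
    intro a b
    rw [incl_star, assocLift_star, Unitization.snd_mul, fst_assocLift, fst_assocLift,
      incl_apply_nil, incl_apply_nil, zero_smul, zero_smul, zero_add, zero_add]
  have hgen : ∀ y : X × DendTree X, (assocLift 𝕜 f (Finsupp.single (node nil y.1 y.2) 1)).snd =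
      f y := by
    intro y
    have h : combProd 𝕜 (node nil y.1 y.2) = Finsupp.single (node nil y.1 y.2) 1 := by
      simp [combProd, nil_star]
    rw [← h, assocLift_combProd]
    simp [assocTree]
  refine ⟨Unitization.sndHom 𝕜 𝕜 B ∘ₗ assocLift 𝕜 f ∘ₗ incl 𝕜, ⟨hmul, fun y => ?_⟩, ?_⟩
  · rw [← hgen y, ← incl_single]
    rfl
  · rintro g ⟨hg, hg'⟩
    -- Uniqueness on words, by induction along the leftmost branch. The map `g` is defined on
    -- nonempty trees only, so a single component is treated apart; for longer words `combProd` of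
    -- the left part has no empty-tree term and comes from `FreeDend`.
    have key : ∀ t, g (proj 𝕜 (combProd 𝕜 t)) = (assocLift 𝕜 f (combProd 𝕜 t)).snd := by
      intro t
      induction t with
      | nil =>
        rw [assocLift_combProd]
        simp [assocTree, combProd, proj]
      | node l x r ihl _ =>
        rw [combProd, ← incl_single]
        cases l with
        | nil =>
          rw [combProd, nil_star, proj_incl, incl_single]
          exact (hg' (x, r)).trans (hgen (x, r)).symm
        | node a y b =>
          rw [← incl_proj 𝕜 (combProd 𝕜 (node a y b)) (by simp [combProd_apply_nil]), ← incl_star,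
            proj_incl, hg, ihl, hmul, incl_proj 𝕜 _ (by simp [combProd_apply_nil]), incl_single]
          exact congrArg _ ((hg' (x, r)).trans (hgen (x, r)).symm)
    have h : g ∘ₗ proj 𝕜 ∘ₗ (combEquiv 𝕜).toLinearMap =
        Unitization.sndHom 𝕜 𝕜 B ∘ₗ assocLift 𝕜 f ∘ₗ (combEquiv 𝕜).toLinearMap := by
      refine Finsupp.lhom_ext' fun t => LinearMap.ext_ring ?_
      simpa [combEquiv_single] using key t
    refine LinearMap.ext fun a => ?_
    have ha := LinearMap.congr_fun h ((combEquiv 𝕜).symm (incl 𝕜 a))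
    simpa [proj_incl] using ha

end FreeDend

/-- Realises the generators as a subset of the transported algebra. Injectivity of `j` is not
needed: a function on the range pulls back to `Y`. -/
theorem IsFreeAssocOn.range_equiv {𝕜 : Type u} [Field 𝕜] {Y : Type*} {A A' : Type v}
    [AddCommGroup A] [Module 𝕜 A] [AddCommGroup A'] [Module 𝕜 A'] {m : A →ₗ[𝕜] A →ₗ[𝕜] A}
    {m' : A' →ₗ[𝕜] A' →ₗ[𝕜] A'} {j : Y → A}
    (h : IsFreeAssocOn.{u, v, _, w} 𝕜 m j) (e : A ≃ₗ[𝕜] A') (he : ∀ a b, e (m a b) = m' (e a) (e b)) :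
    IsFreeAssocOn.{u, v, v, w} 𝕜 m' (fun y : Set.range (e ∘ j) => (y : A')) := by
  have he' : ∀ a b, e.symm (m' a b) = m (e.symm a) (e.symm b) := fun a b =>
    e.injective (by simp [he])
  refine ⟨fun a b c => e.symm.injective (by simp only [he', h.1]), fun B _ _ _ _ f => ?_⟩
  obtain ⟨g, ⟨hg, hg'⟩, hu⟩ := h.2 B fun y => f ⟨e (j y), y, rfl⟩
  refine ⟨g ∘ₗ e.symm.toLinearMap, ⟨fun a b => by simp [he', hg], ?_⟩, ?_⟩
  · rintro ⟨_, y, rfl⟩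
    simpa using hg' y
  · rintro g₁ ⟨h1, h2⟩
    have := hu (g₁ ∘ₗ e.toLinearMap) ⟨fun a b => by simp [he, h1], fun y => h2 ⟨e (j y), y, rfl⟩⟩
    rw [← this]
    ext a
    simp

/-- **Loday–Ronco**: a free dendriform algebra is free as an associative algebra. -/
theorem DendriformAlgebra.IsFreeOn.exists_isFreeAssocOn {𝕜 : Type u} [Field 𝕜] {X : Type v}
    {D : Type (max u v)} [AddCommGroup D] [Module 𝕜 D] [DendriformAlgebra 𝕜 D] {ι : X → D}
    (h : IsFreeOn 𝕜 ι) :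
    ∃ Y : Set D, IsFreeAssocOn.{u, max u v, max u v, w} 𝕜
        (DendriformAlgebra.star 𝕜 (D := D)) (fun y : Y => (y : D)) := by
  obtain ⟨e, he⟩ := h.exists_equiv
  exact ⟨_, (FreeDend.isFreeAssocOn_star 𝕜).range_equiv e he⟩

/-! ### Morphisms of operads and ideals -/

namespace NSOperad

variable {𝕜 : Type u} [Field 𝕜]

/-- The kernel of a morphism of operads. -/
def Hom.ker {P : NSOperad.{u, v} 𝕜} {Q : NSOperad.{u, w} 𝕜} (φ : Hom P Q) : OpIdeal P where
  carrier n := LinearMap.ker (φ.toFun n)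
  comp_left n h p q hp := by
    rw [LinearMap.mem_ker] at hp ⊢
    rw [φ.map_comp, hp, map_zero, _root_.zero_apply]
  comp_right n h p q i hq := by
    rw [LinearMap.mem_ker] at hq ⊢
    rw [φ.map_comp]
    exact MultilinearMap.map_coord_zero _ i hq

theorem OpIdeal.subset_span (P : NSOperad.{u, v} 𝕜) (R : ∀ n, Set (P.obj n)) (n : ℕ) :
    R n ⊆ (OpIdeal.span P R).carrier n := by
  intro x hx
  simp only [OpIdeal.span, SetLike.mem_coe, Submodule.mem_sInf]
  rintro S ⟨J, hJ, rfl⟩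
  exact hJ n hx

theorem OpIdeal.span_le {P : NSOperad.{u, v} 𝕜} {R : ∀ n, Set (P.obj n)} (J : OpIdeal P)
    (hJ : ∀ m, R m ⊆ J.carrier m) (n : ℕ) : (OpIdeal.span P R).carrier n ≤ J.carrier n :=
  sInf_le ⟨J, hJ, rfl⟩

/-- The morphism induced on a quotient. -/
def Hom.liftQuotient {P : NSOperad.{u, v} 𝕜} {Q : NSOperad.{u, w} 𝕜} (I : OpIdeal P) (φ : Hom P Q)
    (h : ∀ n, I.carrier n ≤ φ.ker.carrier n) : Hom (P.quotient I) Q where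
  toFun n := (I.carrier n).liftQ (φ.toFun n) (h n)
  map_one := φ.map_one
  map_comp {k r} n hr p q := by
    obtain ⟨p, rfl⟩ := (I.carrier k).mkQ_surjective p
    obtain ⟨q, rfl⟩ : ∃ q' : ∀ i, P.obj (n i), q = fun i => (I.carrier (n i)).mkQ (q' i) :=
      ⟨fun i => I.rep (q i), funext fun i => (I.mkQ_rep _).symm⟩
    exact (congrArg _ (I.compQuot_mkQ n hr p q)).trans (φ.map_comp n hr p q)

/-- A pair of operations. -/
def pair (P : NSOperad.{u, v} 𝕜) {a b : ℕ} (x : P.obj a) (y : P.obj b) :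
    ∀ i : Fin 2, P.obj (![a, b] i)
  | 0 => x
  | 1 => y

/-- The composition of a binary operation with two operations. -/
def compPair (P : NSOperad.{u, v} 𝕜) {a b : ℕ} (m : P.obj 2) (x : P.obj a) (y : P.obj b) :
    P.obj (a + b) :=
  P.comp ![a, b] (by simp) m (P.pair x y)

theorem Hom.map_compPair {P : NSOperad.{u, v} 𝕜} {Q : NSOperad.{u, w} 𝕜} (φ : Hom P Q) {a b : ℕ}
    (m : P.obj 2) (x : P.obj a) (y : P.obj b) :
    φ.toFun (a + b) (P.compPair m x y) =
      Q.compPair (φ.toFun 2 m) (φ.toFun a x) (φ.toFun b y) := by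
  rw [compPair, φ.map_comp, compPair]
  congr 1
  funext i
  match i with
  | 0 => rfl
  | 1 => rfl

end NSOperad

/-- A bilinear map as a multilinear map of two arguments. -/
def LinearMap.toMultilinearPair {𝕜 : Type u} [Field 𝕜] {M : Fin 2 → Type v}
    [∀ i, AddCommGroup (M i)] [∀ i, Module 𝕜 (M i)] {N : Type w} [AddCommGroup N] [Module 𝕜 N]
    (B : M 0 →ₗ[𝕜] M 1 →ₗ[𝕜] N) : MultilinearMap 𝕜 M N where
  toFun x := B (x 0) (x 1)
  map_update_add' {_} x i y z := by
    match i with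
    | 0 => simp
    | 1 => simp
  map_update_smul' {_} x i c y := by
    match i with
    | 0 => simp
    | 1 => simp

/-! ### The total algebra of a quotient of a free operad -/

namespace freeBinary

variable (𝕜 : Type u) [Field 𝕜] {E : Type}

theorem leaves_node (e : E) (l r : BinTree E) :
    (BinTree.node e l r).leaves = l.leaves + r.leaves := rfl

theorem leaves_gen (e : E) : (BinTree.node e .leaf .leaf).leaves = 2 := rfl

theorem leaves_left (e f : E) :
    (BinTree.node e (.node f .leaf .leaf) .leaf).leaves = 3 := rfl

theorem leaves_right (e f : E) :
    (BinTree.node e .leaf (.node f .leaf .leaf)).leaves = 3 := rfl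

/-- A tree as an element of the set of trees with a given number of leaves. -/
def ofTree (t : BinTree E) {n : ℕ} (h : t.leaves = n) : BinTree.OfArity E n := ⟨t, h⟩

@[simp]
theorem ofTree_val (t : BinTree E) {n : ℕ} (h : t.leaves = n) : (ofTree t h).1 = t := rfl

theorem ofTree_eq {n : ℕ} (t : BinTree.OfArity E n) : ofTree t.1 t.2 = t := rfl

/-- A tree as an element of the free operad. -/
noncomputable def mono {n : ℕ} (t : BinTree.OfArity E n) : (freeBinary 𝕜 E).obj n :=
  Finsupp.single t (1 : 𝕜)

variable {𝕜} in
theorem linearMap_ext {n : ℕ} {M : Type w} [AddCommGroup M] [Module 𝕜 M]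
    {f g : (freeBinary 𝕜 E).obj n →ₗ[𝕜] M} (h : ∀ t, f (mono 𝕜 t) = g (mono 𝕜 t)) : f = g :=
  Finsupp.lhom_ext' (M := 𝕜) fun t => LinearMap.ext_ring (h t)

variable {𝕜} in
theorem multilinearMap_ext {k : ℕ} {n : Fin k → ℕ} {M : Type w} [AddCommGroup M] [Module 𝕜 M]
    {f g : MultilinearMap 𝕜 (fun i => (freeBinary 𝕜 E).obj (n i)) M}
    (h : ∀ s : ∀ i, BinTree.OfArity E (n i),
      f (fun i => mono 𝕜 (s i)) = g (fun i => mono 𝕜 (s i))) : f = g := by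
  refine Module.Basis.ext_multilinear
    (fun _ => (Finsupp.basisSingleOne : Module.Basis _ 𝕜 (BinTree.OfArity E _ →₀ 𝕜)))
    fun s => ?_
  have h1 : (fun i => (Finsupp.basisSingleOne : Module.Basis _ 𝕜 (BinTree.OfArity E (n i) →₀ 𝕜))
      (s i)) = fun i => Finsupp.single (s i) 1 := by
    simp only [Finsupp.coe_basisSingleOne]
  exact (congrArg f h1).trans ((h s).trans (congrArg g h1).symm)

theorem comp_mono {k r : ℕ} (n : Fin k → ℕ) (h : ∑ i, n i = r) (t : BinTree.OfArity E k)
    (s : ∀ i, BinTree.OfArity E (n i)) :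
    (freeBinary 𝕜 E).comp n h (mono 𝕜 t) (fun i => mono 𝕜 (s i)) =
      mono 𝕜 (BinTree.OfArity.graft n h t s) :=
  FreeBinary.comp_single 𝕜 n h t s

/-- The linear map from a component of the free operad with prescribed values on trees. -/
noncomputable def linearLift {n : ℕ} {M : Type w} [AddCommGroup M] [Module 𝕜 M]
    (f : BinTree.OfArity E n → M) : (freeBinary 𝕜 E).obj n →ₗ[𝕜] M :=
  Finsupp.linearCombination 𝕜 f

theorem linearLift_mono {n : ℕ} {M : Type w} [AddCommGroup M] [Module 𝕜 M]
    (f : BinTree.OfArity E n → M) (t : BinTree.OfArity E n) :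
    linearLift 𝕜 f (mono 𝕜 t) = f t :=
  (Finsupp.linearCombination_single 𝕜 1 t).trans (one_smul 𝕜 _)

/-- The inclusion of a component of the free operad into the span of all trees. -/
noncomputable def incl (n : ℕ) : (freeBinary 𝕜 E).obj n →ₗ[𝕜] (BinTree E →₀ 𝕜) :=
  linearLift 𝕜 fun t => Finsupp.single t.1 1

/-- The projection of the span of all trees onto a component of the free operad. -/
noncomputable def restrict (n : ℕ) : (BinTree E →₀ 𝕜) →ₗ[𝕜] (freeBinary 𝕜 E).obj n :=
  Finsupp.linearCombination 𝕜 fun t => if h : t.leaves = n then mono 𝕜 (ofTree t h) else 0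

@[simp]
theorem incl_mono (n : ℕ) (t : BinTree.OfArity E n) :
    incl 𝕜 n (mono 𝕜 t) = Finsupp.single t.1 1 :=
  linearLift_mono 𝕜 _ t

theorem restrict_incl (n : ℕ) (p : (freeBinary 𝕜 E).obj n) :
    restrict 𝕜 n (incl 𝕜 n p) = p := by
  suffices h : restrict 𝕜 n ∘ₗ incl 𝕜 n = LinearMap.id (M := (freeBinary 𝕜 E).obj n) from
    LinearMap.congr_fun h p
  refine linearMap_ext fun t => ?_
  have ht := t.2
  simp [restrict, ht, ofTree_eq]

theorem restrict_incl_of_ne {m n : ℕ} (h : m ≠ n) (p : (freeBinary 𝕜 E).obj n) :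
    restrict 𝕜 m (incl 𝕜 n p) = 0 := by
  suffices h : restrict 𝕜 m ∘ₗ incl 𝕜 n = (0 : (freeBinary 𝕜 E).obj n →ₗ[𝕜] _) from
    LinearMap.congr_fun h p
  refine linearMap_ext fun t => ?_
  have ht : t.1.leaves ≠ m := fun h' => h (h'.symm.trans t.2)
  simp [restrict, ht]

theorem incl_injective (n : ℕ) : Function.Injective (incl (E := E) 𝕜 n) :=
  Function.LeftInverse.injective (restrict_incl 𝕜 n)

/-- The bilinear operation `e` on the span of all trees. -/
noncomputable def op (e : E) :
    (BinTree E →₀ 𝕜) →ₗ[𝕜] (BinTree E →₀ 𝕜) →ₗ[𝕜] (BinTree E →₀ 𝕜) :=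
  Finsupp.linearCombination 𝕜 fun s => Finsupp.lmapDomain 𝕜 𝕜 fun t => .node e s t

@[simp]
theorem op_single (e : E) (s t : BinTree E) (c : 𝕜) :
    op 𝕜 e (Finsupp.single s 1) (Finsupp.single t c) = Finsupp.single (.node e s t) c := by
  simp [op]

theorem incl_comp_gen {r : ℕ} (n : Fin 2 → ℕ) (h : ∑ i, n i = r) (e : E)
    (q : ∀ i, (freeBinary 𝕜 E).obj (n i)) :
    incl 𝕜 r ((freeBinary 𝕜 E).comp n h (gen 𝕜 e) q) =
      op 𝕜 e (incl 𝕜 (n 0) (q 0)) (incl 𝕜 (n 1) (q 1)) := by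
  suffices H : (incl 𝕜 r).compMultilinearMap ((freeBinary 𝕜 E).comp n h (gen 𝕜 e)) =
      LinearMap.toMultilinearPair (M := fun i => (freeBinary 𝕜 E).obj (n i))
        ((op 𝕜 e).compl₁₂ (incl 𝕜 (n 0)) (incl 𝕜 (n 1))) from DFunLike.congr_fun H q
  refine multilinearMap_ext fun s => ?_
  have h1 := comp_mono 𝕜 n h (ofTree _ (leaves_gen e)) s
  refine (congrArg (incl 𝕜 r) h1).trans ?_
  rw [incl_mono]
  simp [LinearMap.toMultilinearPair, BinTree.OfArity.graft, BinTree.graft, BinTree.extend,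
    BinTree.leaves]

theorem incl_compPair {a b : ℕ} (e : E) (x : (freeBinary 𝕜 E).obj a) (y : (freeBinary 𝕜 E).obj b) :
    incl 𝕜 (a + b) ((freeBinary 𝕜 E).compPair (gen 𝕜 e) x y) =
      op 𝕜 e (incl 𝕜 a x) (incl 𝕜 b y) :=
  incl_comp_gen 𝕜 ![a, b] _ e _

theorem compPair_mono (e : E) (l r : BinTree E) :
    (freeBinary 𝕜 E).compPair (gen 𝕜 e) (mono 𝕜 (ofTree l rfl)) (mono 𝕜 (ofTree r rfl)) =
      mono 𝕜 (n := l.leaves + r.leaves) (ofTree _ (leaves_node e l r)) := by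
  refine incl_injective 𝕜 _ ?_
  simp only [incl_compPair, incl_mono, op_single, ofTree_val]

variable {𝕜}

/-- Morphisms from a free operad that agree on the generators are equal. -/
theorem hom_apply_eq {Q : NSOperad.{u, w} 𝕜} {φ ψ : NSOperad.Hom (freeBinary 𝕜 E) Q}
    (h : ∀ e, φ.toFun 2 (gen 𝕜 e) = ψ.toFun 2 (gen 𝕜 e)) (n : ℕ) : φ.toFun n = ψ.toFun n := by
  refine linearMap_ext fun t => ?_
  suffices H : ∀ t : BinTree E, φ.toFun t.leaves (mono 𝕜 (ofTree t rfl)) =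
      ψ.toFun t.leaves (mono 𝕜 (ofTree t rfl)) by
    obtain ⟨t, rfl⟩ := t
    exact H t
  intro t
  induction t with
  | leaf => exact φ.map_one.trans ψ.map_one.symm
  | node e l r hl hr =>
    have h1 := φ.map_compPair (gen 𝕜 e) (mono 𝕜 (ofTree l rfl)) (mono 𝕜 (ofTree r rfl))
    have h2 := ψ.map_compPair (gen 𝕜 e) (mono 𝕜 (ofTree l rfl)) (mono 𝕜 (ofTree r rfl))
    rw [compPair_mono] at h1 h2
    rw [h, hl, hr] at h1
    exact h1.trans h2.symm

variable (I : NSOperad.OpIdeal (freeBinary 𝕜 E))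

/-- The span of the components of an ideal of the free operad. -/
noncomputable def total : Submodule 𝕜 (BinTree E →₀ 𝕜) :=
  ⨆ n, (I.carrier n).map (incl 𝕜 n)

/-- Nothing is lost by summing over all arities: the projection to arity `n` is the identity on the
piece of arity `n` and kills the others. -/
theorem incl_mem_total {n : ℕ} (p : (freeBinary 𝕜 E).obj n) :
    incl 𝕜 n p ∈ total I ↔ p ∈ I.carrier n := by
  refine ⟨fun h => ?_, fun h => Submodule.mem_iSup_of_mem n (Submodule.mem_map_of_mem h)⟩
  have h1 : total I ≤ (I.carrier n).comap (restrict 𝕜 n) := by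
    refine iSup_le fun m => Submodule.map_le_iff_le_comap.2 fun q hq => ?_
    rw [Submodule.mem_comap, Submodule.mem_comap]
    by_cases hmn : n = m
    · subst hmn
      rwa [restrict_incl]
    · rw [restrict_incl_of_ne 𝕜 hmn]
      exact zero_mem _
  have h2 := h1 h
  rwa [Submodule.mem_comap, restrict_incl] at h2

/-- An operadic ideal absorbs insertion into an input of a generator, so its total space is an ideal
for the binary operations, which therefore descend to the quotient. -/
theorem op_left_mem_total (e : E) {p : BinTree E →₀ 𝕜} (hp : p ∈ total I) (q : BinTree E →₀ 𝕜) :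
    op 𝕜 e p q ∈ total I := by
  induction q using Finsupp.induction_linear with
  | zero => simp
  | add q q' h h' => rw [map_add]; exact add_mem h h'
  | single t c =>
    rw [← mul_one c, ← smul_eq_mul, ← Finsupp.smul_single, map_smul]
    refine Submodule.smul_mem _ _ ?_
    have h1 : total I ≤ (total I).comap ((op 𝕜 e).flip (Finsupp.single t 1)) := by
      refine iSup_le fun m => Submodule.map_le_iff_le_comap.2 fun x hx => ?_
      rw [Submodule.mem_comap, Submodule.mem_comap, LinearMap.flip_apply]
      have h2 := incl_compPair 𝕜 e x (mono 𝕜 (ofTree t rfl))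
      rw [incl_mono, ofTree_val] at h2
      rw [← h2, incl_mem_total]
      exact I.comp_right _ _ _ _ 0 hx
    exact h1 hp

theorem op_right_mem_total (e : E) {q : BinTree E →₀ 𝕜} (hq : q ∈ total I) (p : BinTree E →₀ 𝕜) :
    op 𝕜 e p q ∈ total I := by
  induction p using Finsupp.induction_linear with
  | zero => simp
  | add p p' h h' => rw [map_add]; exact add_mem h h'
  | single t c =>
    rw [← mul_one c, ← smul_eq_mul, ← Finsupp.smul_single, map_smul, LinearMap.smul_apply]
    refine Submodule.smul_mem _ _ ?_
    have h1 : total I ≤ (total I).comap (op 𝕜 e (Finsupp.single t 1)) := by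
      refine iSup_le fun m => Submodule.map_le_iff_le_comap.2 fun x hx => ?_
      rw [Submodule.mem_comap, Submodule.mem_comap]
      have h2 := incl_compPair 𝕜 e (mono 𝕜 (ofTree t rfl)) x
      rw [incl_mono, ofTree_val] at h2
      rw [← h2, incl_mem_total]
      exact I.comp_right _ _ _ _ 1 hx
    exact h1 hq

/-- The direct sum of the components of the quotient of the free operad by an ideal. -/
abbrev Total : Type u := (BinTree E →₀ 𝕜) ⧸ total I

/-- The class of a tree. -/
noncomputable def cls (t : BinTree E) : Total I := (total I).mkQ (Finsupp.single t 1)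

/-- The bilinear operation induced by `e` on the quotient. -/
noncomputable def opQuot (e : E) : Total I →ₗ[𝕜] Total I →ₗ[𝕜] Total I :=
  -- The operation descends in its first argument, then, after a flip, in its second.
  ((total I).liftQ ((total I).liftQ ((op 𝕜 e).compr₂ (total I).mkQ) fun _ hp =>
    LinearMap.mem_ker.2 <| LinearMap.ext fun _ =>
      (Submodule.Quotient.mk_eq_zero _).2 (op_left_mem_total I e hp _)).flip fun _ hq =>
    LinearMap.mem_ker.2 <| Submodule.linearMap_qext _ <| LinearMap.ext fun _ =>
      (Submodule.Quotient.mk_eq_zero _).2 (op_right_mem_total I e hq _)).flip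

theorem opQuot_cls (e : E) (s t : BinTree E) :
    opQuot I e (cls I s) (cls I t) = cls I (.node e s t) := by
  rw [cls, cls, cls, ← op_single]
  rfl

theorem total_ext {M : Type*} [AddCommGroup M] [Module 𝕜 M] {f g : Total I →ₗ[𝕜] M}
    (h : ∀ t, f (cls I t) = g (cls I t)) : f = g :=
  Submodule.linearMap_qext _ <| Finsupp.lhom_ext' fun t => LinearMap.ext_ring (h t)

theorem trilinear_ext {M : Type*} [AddCommGroup M] [Module 𝕜 M]
    {f g : Total I →ₗ[𝕜] Total I →ₗ[𝕜] Total I →ₗ[𝕜] M}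
    (h : ∀ s t u, f (cls I s) (cls I t) (cls I u) = g (cls I s) (cls I t) (cls I u)) : f = g :=
  total_ext I fun s => total_ext I fun t => total_ext I fun u => h s t u

/-- The trilinear map `(a, b, c) ↦ e (f (a, b), c)`. -/
noncomputable def leftAssoc (e f : E) :
    Total I →ₗ[𝕜] Total I →ₗ[𝕜] Total I →ₗ[𝕜] Total I :=
  (opQuot I f).compr₂ (opQuot I e)

/-- The trilinear map `(a, b, c) ↦ e (a, f (b, c))`. -/
noncomputable def rightAssoc (e f : E) :
    Total I →ₗ[𝕜] Total I →ₗ[𝕜] Total I →ₗ[𝕜] Total I :=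
  (LinearMap.llcomp 𝕜 _ _ _ ∘ₗ opQuot I e).compl₂ (opQuot I f)

/-- The value of a ternary operation at three trees. -/
noncomputable def substTrees (x : Fin 3 → BinTree E) :
    (freeBinary 𝕜 E).obj 3 →ₗ[𝕜] Total I where
  toFun p := (total I).mkQ (incl 𝕜 _ ((freeBinary 𝕜 E).comp (fun i => (x i).leaves) rfl p
    fun i => mono 𝕜 (ofTree (x i) rfl)))
  map_add' p q := by simp only [map_add, _root_.add_apply]
  map_smul' c p := by simp only [map_smul, _root_.smul_apply, RingHom.id_apply]

/-- Turns a ternary relation of the operad into an identity of the total algebra: trees span it, so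
by trilinearity it suffices to substitute trees. -/
theorem substTrees_eq_zero (x : Fin 3 → BinTree E) (p : (freeBinary 𝕜 E).obj 3)
    (hp : p ∈ I.carrier 3) : substTrees I x p = 0 :=
  (Submodule.Quotient.mk_eq_zero _).2 ((incl_mem_total I _).2 (I.comp_left _ _ p _ hp))

theorem substTrees_left (x : Fin 3 → BinTree E) (e f : E) :
    substTrees I x (left 𝕜 e f) = leftAssoc I e f (cls I (x 0)) (cls I (x 1)) (cls I (x 2)) := by
  have h1 := comp_mono 𝕜 (fun i => (x i).leaves) rfl
    (ofTree _ (leaves_left e f)) fun i => ofTree (x i) rfl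
  refine (congrArg (fun z => (total I).mkQ (incl 𝕜 _ z)) h1).trans ?_
  rw [incl_mono]
  simp only [leftAssoc, LinearMap.compr₂_apply, opQuot_cls]
  simp [cls, BinTree.OfArity.graft, BinTree.graft, BinTree.extend, BinTree.leaves]

theorem substTrees_right (x : Fin 3 → BinTree E) (e f : E) :
    substTrees I x (right 𝕜 e f) =
      rightAssoc I e f (cls I (x 0)) (cls I (x 1)) (cls I (x 2)) := by
  have h1 := comp_mono 𝕜 (fun i => (x i).leaves) rfl
    (ofTree _ (leaves_right e f)) fun i => ofTree (x i) rfl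
  refine (congrArg (fun z => (total I).mkQ (incl 𝕜 _ z)) h1).trans ?_
  have h2 : rightAssoc I e f (cls I (x 0)) (cls I (x 1)) (cls I (x 2)) =
    opQuot I e (cls I (x 0)) (opQuot I f (cls I (x 1)) (cls I (x 2))) := rfl
  rw [incl_mono]
  simp only [h2, opQuot_cls]
  simp [cls, BinTree.OfArity.graft, BinTree.graft, BinTree.extend, BinTree.leaves]

end freeBinary

/-! ### The associative operad is spanned by one element in each arity -/

namespace As

open freeBinary

variable (𝕜 : Type u) [Field 𝕜]

/-- The ideal of the associativity relation. -/
noncomputable abbrev ideal : NSOperad.OpIdeal (freeBinary 𝕜 Unit) := .span _ (AsRel 𝕜)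

theorem opQuot_assoc (a b c : Total (ideal 𝕜)) :
    opQuot (ideal 𝕜) () (opQuot (ideal 𝕜) () a b) c =
      opQuot (ideal 𝕜) () a (opQuot (ideal 𝕜) () b c) := by
  suffices h : leftAssoc (ideal 𝕜) () () = rightAssoc (ideal 𝕜) () () from
    DFunLike.congr_fun (DFunLike.congr_fun (DFunLike.congr_fun h a) b) c
  refine trilinear_ext _ fun s t u => ?_
  have h := substTrees_eq_zero (ideal 𝕜) ![s, t, u] _
    (NSOperad.OpIdeal.subset_span _ (AsRel 𝕜) 3 AsRel.assoc)
  rw [map_sub, sub_eq_zero, substTrees_left, substTrees_right] at h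
  exact h

/-- The powers of the generator. -/
noncomputable def pow : ℕ → Total (ideal 𝕜)
  | 0 => cls _ .leaf
  | n + 1 => opQuot _ () (pow n) (cls _ .leaf)

/-- `pow n` has `n + 1` factors, which accounts for the shift by one here and in `cls_eq_pow`. -/
theorem opQuot_pow (m n : ℕ) : opQuot _ () (pow 𝕜 m) (pow 𝕜 n) = pow 𝕜 (m + n + 1) := by
  induction n with
  | zero => rfl
  | succ n ih => rw [pow, ← opQuot_assoc, ih]; rfl

theorem cls_eq_pow (t : BinTree Unit) : cls (ideal 𝕜) t = pow 𝕜 (t.leaves - 1) := by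
  induction t with
  | leaf => rfl
  | node e l r hl hr =>
    rw [← opQuot_cls, hl, hr, opQuot_pow]
    congr 1
    have := l.leaves_pos
    have := r.leaves_pos
    simp only [BinTree.leaves]
    omega

/-- Trees with the same number of leaves represent the same operation. -/
theorem mono_sub_mono_mem {n : ℕ} (s t : BinTree.OfArity Unit n) :
    mono 𝕜 s - mono 𝕜 t ∈ (ideal 𝕜).carrier n := by
  rw [← incl_mem_total, map_sub, incl_mono, incl_mono]
  have h : cls (ideal 𝕜) s.1 = cls (ideal 𝕜) t.1 := by
    rw [cls_eq_pow, cls_eq_pow, s.2, t.2]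
  exact (Submodule.Quotient.eq _).1 h

end As

/-! ### The total algebra of the dendriform operad -/

namespace Dend

open freeBinary DendriformAlgebra

variable (𝕜 : Type u) [Field 𝕜]

/-- The ideal of the dendriform relations. -/
noncomputable abbrev ideal : NSOperad.OpIdeal (freeBinary 𝕜 DendGen) := .span _ (DendRel 𝕜)

theorem leftAssoc_prec_prec : leftAssoc (ideal 𝕜) .prec .prec =
    rightAssoc (ideal 𝕜) .prec .prec + rightAssoc (ideal 𝕜) .prec .succ := by
  refine trilinear_ext _ fun s t u => ?_
  have h := substTrees_eq_zero (ideal 𝕜) ![s, t, u] _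
    (NSOperad.OpIdeal.subset_span _ (DendRel 𝕜) 3 DendRel.prec_prec)
  rw [map_sub, map_add, sub_eq_zero, substTrees_left, substTrees_right, substTrees_right] at h
  exact h

theorem leftAssoc_prec_succ : leftAssoc (ideal 𝕜) .prec .succ =
    rightAssoc (ideal 𝕜) .succ .prec := by
  refine trilinear_ext _ fun s t u => ?_
  have h := substTrees_eq_zero (ideal 𝕜) ![s, t, u] _
    (NSOperad.OpIdeal.subset_span _ (DendRel 𝕜) 3 DendRel.succ_prec)
  rw [map_sub, sub_eq_zero, substTrees_left, substTrees_right] at h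
  exact h

theorem leftAssoc_succ_prec : leftAssoc (ideal 𝕜) .succ .prec + leftAssoc (ideal 𝕜) .succ .succ =
    rightAssoc (ideal 𝕜) .succ .succ := by
  refine trilinear_ext _ fun s t u => ?_
  have h := substTrees_eq_zero (ideal 𝕜) ![s, t, u] _
    (NSOperad.OpIdeal.subset_span _ (DendRel 𝕜) 3 DendRel.succ_succ)
  rw [map_sub, map_add, sub_eq_zero, substTrees_left, substTrees_left, substTrees_right] at h
  exact h

noncomputable instance : DendriformAlgebra 𝕜 (Total (ideal 𝕜)) where
  prec := opQuot (ideal 𝕜) .prec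
  succ := opQuot (ideal 𝕜) .succ
  prec_prec a b c := DFunLike.congr_fun (DFunLike.congr_fun
    (DFunLike.congr_fun (leftAssoc_prec_prec 𝕜) a) b) c
  succ_prec a b c := DFunLike.congr_fun (DFunLike.congr_fun
    (DFunLike.congr_fun (leftAssoc_prec_succ 𝕜) a) b) c
  succ_succ a b c := DFunLike.congr_fun (DFunLike.congr_fun
    (DFunLike.congr_fun (leftAssoc_succ_prec 𝕜) a) b) c

end Dend

/-! ### Evaluation of trees -/

namespace BinTree

variable {𝕜 : Type u} [Field 𝕜] {E : Type} {D : Type v} [AddCommGroup D] [Module 𝕜 D]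
  (m : E → D →ₗ[𝕜] D →ₗ[𝕜] D)

/-- The value of a tree in an algebra; the leaf number `i` is sent to `a i`. -/
def eval : BinTree E → (ℕ → D) → D
  | leaf, a => a 0
  | node e l r, a => m e (eval l a) (eval r fun i => a (l.leaves + i))

theorem eval_congr (t : BinTree E) {a b : ℕ → D} (h : ∀ i < t.leaves, a i = b i) :
    t.eval m a = t.eval m b := by
  induction t generalizing a b with
  | leaf => exact h 0 Nat.one_pos
  | node e l r hl hr =>
    simp only [leaves] at h
    simp only [eval]
    rw [hl fun i hi => h i (by omega), hr fun i hi => h _ (by omega)]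

theorem eval_graft (t : BinTree E) (f : ℕ → BinTree E) (a : ℕ → D) :
    (t.graft f).eval m a = t.eval m fun i =>
      (f i).eval m fun j => a (∑ b ∈ Finset.range i, (f b).leaves + j) := by
  induction t generalizing f a with
  | leaf => simp [graft, eval]
  | node e l r hl hr =>
    simp only [graft, eval, hl, hr, leaves_graft, Finset.sum_range_add, add_assoc]

/-- The leaf `i` lies in exactly one of the two subtrees of the root, and the value of the other
does not see the change. -/
theorem eval_update_add (t : BinTree E) (a : ℕ → D) {i : ℕ} (hi : i < t.leaves) (x y : D) :
    t.eval m (Function.update a i (x + y)) =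
      t.eval m (Function.update a i x) + t.eval m (Function.update a i y) := by
  induction t generalizing a i with
  | leaf =>
    obtain rfl : i = 0 := Nat.lt_one_iff.1 hi
    simp [eval]
  | node e l r hl hr =>
    simp only [leaves] at hi
    simp only [eval]
    by_cases h : i < l.leaves
    · have h1 : ∀ z, (fun j => Function.update a i z (l.leaves + j)) =
          fun j => a (l.leaves + j) := fun z =>
        funext fun j => Function.update_of_ne (by omega) _ _
      rw [h1, h1, h1, hl a h, map_add, LinearMap.add_apply]
    -- The leaf lies in the right subtree, where its number is `i - l.leaves`.
    · have h1 : ∀ z, (fun j => Function.update a i z (l.leaves + j)) =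
          Function.update (fun j => a (l.leaves + j)) (i - l.leaves) z := fun z => by
        funext j
        by_cases hj : j = i - l.leaves
        · subst hj
          rw [Function.update_self, Nat.add_sub_cancel' (not_lt.1 h), Function.update_self]
        · rw [Function.update_of_ne hj, Function.update_of_ne (by omega)]
      have h2 : ∀ z, l.eval m (Function.update a i z) = l.eval m a := fun z =>
        eval_congr m l fun j hj => Function.update_of_ne (by omega) _ _
      rw [h1, h1, h1, h2, h2, h2, hr _ (by omega), map_add]

theorem eval_update_smul (t : BinTree E) (a : ℕ → D) {i : ℕ} (hi : i < t.leaves) (c : 𝕜) (x : D) :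
    t.eval m (Function.update a i (c • x)) = c • t.eval m (Function.update a i x) := by
  induction t generalizing a i with
  | leaf =>
    obtain rfl : i = 0 := Nat.lt_one_iff.1 hi
    simp [eval]
  | node e l r hl hr =>
    simp only [leaves] at hi
    simp only [eval]
    by_cases h : i < l.leaves
    · have h1 : ∀ z, (fun j => Function.update a i z (l.leaves + j)) =
          fun j => a (l.leaves + j) := fun z =>
        funext fun j => Function.update_of_ne (by omega) _ _
      rw [h1, h1, hl a h, map_smul, LinearMap.smul_apply]
    · have h1 : ∀ z, (fun j => Function.update a i z (l.leaves + j)) =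
          Function.update (fun j => a (l.leaves + j)) (i - l.leaves) z := fun z => by
        funext j
        by_cases hj : j = i - l.leaves
        · subst hj
          rw [Function.update_self, Nat.add_sub_cancel' (not_lt.1 h), Function.update_self]
        · rw [Function.update_of_ne hj, Function.update_of_ne (by omega)]
      have h2 : ∀ z, l.eval m (Function.update a i z) = l.eval m a := fun z =>
        eval_congr m l fun j hj => Function.update_of_ne (by omega) _ _
      rw [h1, h1, h2, h2, hr _ (by omega), map_smul]

end BinTree

/-- The extension of a finite sequence by zero. -/
def extendZero {D : Type v} [Zero D] {k : ℕ} (a : Fin k → D) (i : ℕ) : D :=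
  if h : i < k then a ⟨i, h⟩ else 0

theorem extendZero_val {D : Type v} [Zero D] {k : ℕ} (a : Fin k → D) (i : Fin k) :
    extendZero a i = a i := by
  simp [extendZero]

theorem extendZero_update {D : Type v} [Zero D] {k : ℕ} [DecidableEq (Fin k)] (a : Fin k → D)
    (i : Fin k) (x : D) :
    extendZero (Function.update a i x) = Function.update (extendZero a) i x := by
  funext j
  by_cases hj : j < k
  · lift j to Fin k using hj
    rw [extendZero_val]
    by_cases h : j = i
    · subst h; simp
    · rw [Function.update_of_ne h, Function.update_of_ne (by simpa [Fin.ext_iff] using h),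
        extendZero_val]
  · have h : j ≠ i := by rintro rfl; exact hj i.2
    rw [Function.update_of_ne h, extendZero, extendZero, dif_neg hj, dif_neg hj]

namespace freeBinary

variable {𝕜 : Type u} [Field 𝕜] {E : Type} {D : Type v} [AddCommGroup D] [Module 𝕜 D]
  (m : E → D →ₗ[𝕜] D →ₗ[𝕜] D)

/-- The value of a tree as a multilinear function of the values of its leaves. -/
def evalMulti {k : ℕ} (t : BinTree.OfArity E k) : MultilinearMap 𝕜 (fun _ : Fin k => D) D where
  toFun a := t.1.eval m (extendZero a)
  map_update_add' a i x y := by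
    simp only [extendZero_update]
    exact t.1.eval_update_add m _ (i.2.trans_eq t.2.symm) x y
  map_update_smul' a i c x := by
    simp only [extendZero_update]
    exact t.1.eval_update_smul m _ (i.2.trans_eq t.2.symm) c x

/-- The value of an operation in an algebra. -/
noncomputable def eval (n : ℕ) (a : ℕ → D) : (freeBinary 𝕜 E).obj n →ₗ[𝕜] D :=
  linearLift 𝕜 fun t => t.1.eval m a

@[simp]
theorem eval_mono {n : ℕ} (a : ℕ → D) (t : BinTree.OfArity E n) :
    eval m n a (mono 𝕜 t) = t.1.eval m a :=
  linearLift_mono 𝕜 _ t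

/-- Linearity in `p` and multilinearity in `q` reduce this to trees, where it is
`BinTree.eval_graft`. The input `i` reads the block of `a` that starts at n₀ + … + nᵢ₋₁. The zeros
of `extendZero` are never read. -/
theorem eval_comp {k r : ℕ} (n : Fin k → ℕ) (h : ∑ i, n i = r) (p : (freeBinary 𝕜 E).obj k)
    (q : ∀ i, (freeBinary 𝕜 E).obj (n i)) (a : ℕ → D) :
    eval m r a ((freeBinary 𝕜 E).comp n h p q) =
      eval m k (extendZero fun i => eval m (n i)
        (fun j => a (∑ b ∈ Finset.range i, extendZero n b + j)) (q i)) p := by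
  suffices H : ∀ t : BinTree.OfArity E k,
      (eval m r a).compMultilinearMap ((freeBinary 𝕜 E).comp n h (mono 𝕜 t)) =
        (evalMulti m t).compLinearMap fun i => eval m (n i)
          fun j => a (∑ b ∈ Finset.range i, extendZero n b + j) by
    let L : (freeBinary 𝕜 E).obj k →ₗ[𝕜] D :=
      { toFun := fun p => eval m r a ((freeBinary 𝕜 E).comp n h p q)
        map_add' := fun p p' => by simp only [map_add, _root_.add_apply]
        map_smul' := fun c p => by simp only [map_smul, _root_.smul_apply, RingHom.id_apply] }
    suffices hL : L = eval m k (extendZero fun i => eval m (n i)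
        (fun j => a (∑ b ∈ Finset.range i, extendZero n b + j)) (q i)) from
      LinearMap.congr_fun hL p
    refine linearMap_ext fun t => ?_
    rw [eval_mono]
    exact DFunLike.congr_fun (H t) q
  intro t
  refine multilinearMap_ext fun s => ?_
  rw [LinearMap.compMultilinearMap_apply, comp_mono, eval_mono]
  simp only [MultilinearMap.compLinearMap_apply, eval_mono]
  refine (BinTree.eval_graft m t.1 _ a).trans (BinTree.eval_congr m t.1 fun i hi => ?_)
  rw [t.2] at hi
  lift i to Fin k using hi
  rw [extendZero_val, BinTree.extend_val]
  refine BinTree.eval_congr m _ fun j _ => ?_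
  congr 2
  refine Finset.sum_congr rfl fun b hb => ?_
  have hb' : b < k := (Finset.mem_range.1 hb).trans i.2
  simp only [BinTree.extend, extendZero, hb', dif_pos, (s _).2]

/-- The ideal of the operations that vanish in an algebra. -/
noncomputable def vanishing : NSOperad.OpIdeal (freeBinary 𝕜 E) where
  carrier n := ⨅ a, LinearMap.ker (eval m n a)
  comp_left n h p q hp := by
    simp only [Submodule.mem_iInf, LinearMap.mem_ker] at hp ⊢
    intro a
    rw [eval_comp, hp]
  comp_right {k r} n h p q i hq := by
    simp only [Submodule.mem_iInf, LinearMap.mem_ker] at hq ⊢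
    intro a
    rw [eval_comp]
    generalize hb : (fun i => eval m (n i)
        (fun j => a (∑ b ∈ Finset.range i, extendZero n b + j)) (q i)) = b
    -- The operation `q i` vanishes on every sequence, in particular on the shifted one.
    have hbi : b i = 0 := by rw [← hb]; exact hq _
    suffices H : eval m k (extendZero b) = 0 by rw [H, LinearMap.zero_apply]
    refine linearMap_ext fun t => ?_
    rw [eval_mono]
    exact (evalMulti m t).map_coord_zero i hbi

end freeBinary

/-! ### Evaluation of the operations of `Dend` in dendriform algebras -/

namespace Dend

open freeBinary DendriformAlgebra

variable {𝕜 : Type u} [Field 𝕜] {D : Type v} [AddCommGroup D] [Module 𝕜 D] [DendriformAlgebra 𝕜 D]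

variable (𝕜 D) in
/-- The operations of a dendriform algebra. -/
def ops : DendGen → D →ₗ[𝕜] D →ₗ[𝕜] D
  | .prec => DendriformAlgebra.prec
  | .succ => DendriformAlgebra.succ

/-- The operations vanishing in `D` form an ideal, and it contains the three relations by the
axioms. This is what lets `Dend` act on `D`. -/
theorem ideal_le_vanishing (n : ℕ) :
    (ideal 𝕜).carrier n ≤ (vanishing (ops 𝕜 D)).carrier n := by
  refine NSOperad.OpIdeal.span_le _ (fun n x hx => ?_) n
  simp only [vanishing, SetLike.mem_coe, Submodule.mem_iInf, LinearMap.mem_ker]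
  intro a
  have hl : ∀ e f, eval (ops 𝕜 D) 3 a (left 𝕜 e f) =
      ops 𝕜 D e (ops 𝕜 D f (a 0) (a 1)) (a 2) := fun e f =>
    eval_mono (ops 𝕜 D) a (ofTree _ (leaves_left e f))
  have hr : ∀ e f, eval (ops 𝕜 D) 3 a (right 𝕜 e f) =
      ops 𝕜 D e (a 0) (ops 𝕜 D f (a 1) (a 2)) := fun e f =>
    eval_mono (ops 𝕜 D) a (ofTree _ (leaves_right e f))
  cases hx with
  | prec_prec => simp [hl, hr, ops, DendriformAlgebra.prec_prec]
  | succ_prec => simp [hl, hr, ops, DendriformAlgebra.succ_prec]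
  | succ_succ => simp [hl, hr, ops, DendriformAlgebra.succ_succ]

/-- The value of an operation of `Dend` in a dendriform algebra. -/
noncomputable def eval (n : ℕ) (a : ℕ → D) : (Dend 𝕜).obj n →ₗ[𝕜] D :=
  ((ideal 𝕜).carrier n).liftQ (freeBinary.eval (ops 𝕜 D) n a) fun p hp => by
    have := ideal_le_vanishing (D := D) n hp
    simp only [vanishing, Submodule.mem_iInf] at this
    exact this a

variable (𝕜) in
/-- The projection of the free operad onto `Dend`. -/
noncomputable def mk : NSOperad.Hom (freeBinary 𝕜 DendGen) (Dend 𝕜) :=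
  (freeBinary 𝕜 DendGen).quotientHom _

theorem mk_surjective (n : ℕ) : Function.Surjective ((mk 𝕜).toFun n) :=
  Submodule.mkQ_surjective _

theorem eval_mk (n : ℕ) (a : ℕ → D) (p : (freeBinary 𝕜 DendGen).obj n) :
    eval n a ((mk 𝕜).toFun n p) = freeBinary.eval (ops 𝕜 D) n a p := rfl

theorem eval_comp {k r : ℕ} (n : Fin k → ℕ) (h : ∑ i, n i = r) (p : (Dend 𝕜).obj k)
    (q : ∀ i, (Dend 𝕜).obj (n i)) (a : ℕ → D) :
    eval r a ((Dend 𝕜).comp n h p q) =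
      eval k (extendZero fun i => eval (n i)
        (fun j => a (∑ b ∈ Finset.range i, extendZero n b + j)) (q i)) p := by
  obtain ⟨p, rfl⟩ := mk_surjective k p
  choose q' hq' using fun i => mk_surjective (n i) (q i)
  obtain rfl : (fun i => (mk 𝕜).toFun (n i) (q' i)) = q := funext hq'
  rw [← (mk 𝕜).map_comp]
  simp only [eval_mk, freeBinary.eval_comp]

end Dend

/-! ### The dendriform operad and the free dendriform algebra on one generator -/

namespace DendTree

variable (𝕜 : Type u) [Field 𝕜] {X : Type v}

theorem star_mem_supported {m n : ℕ} {p q : DendTree X →₀ 𝕜}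
    (hp : p ∈ Finsupp.supported 𝕜 𝕜 {s : DendTree X | s.size = m})
    (hq : q ∈ Finsupp.supported 𝕜 𝕜 {s : DendTree X | s.size = n}) :
    star 𝕜 p q ∈ Finsupp.supported 𝕜 𝕜 {s : DendTree X | s.size = m + n} := by
  refine (Submodule.map₂_le.1 ?_ : _) p hp q hq
  rw [Finsupp.supported_eq_span_single, Finsupp.supported_eq_span_single,
    Submodule.map₂_span_span, Submodule.span_le]
  rintro _ ⟨_, ⟨s, rfl, rfl⟩, _, ⟨t, rfl, rfl⟩, rfl⟩
  have h := starTree_mem_supported 𝕜 s t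
  rw [← star_single] at h
  exact h

end DendTree

namespace FreeDend

open DendTree

variable (𝕜 : Type u) [Field 𝕜] (X : Type v)

/-- The span of the trees with `n` internal vertices. -/
noncomputable def homogeneous (n : ℕ) : Submodule 𝕜 (FreeDend 𝕜 X) :=
  Finsupp.supported 𝕜 𝕜 {x | x.1.size + x.2.2.size + 1 = n}

variable {X}

theorem incl_mem_supported {n : ℕ} {a : FreeDend 𝕜 X} (ha : a ∈ homogeneous 𝕜 X n) :
    incl 𝕜 a ∈ Finsupp.supported 𝕜 𝕜 {s : DendTree X | s.size = n} := by
  have := Submodule.mem_map_of_mem (f := incl 𝕜) ha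
  rw [incl, homogeneous, Finsupp.lmapDomain_supported] at this
  refine Finsupp.supported_mono ?_ this
  rintro _ ⟨u, hu, rfl⟩
  exact hu

theorem prec_mem_homogeneous {m n : ℕ} {a b : FreeDend 𝕜 X} (ha : a ∈ homogeneous 𝕜 X m)
    (hb : b ∈ homogeneous 𝕜 X n) :
    DendriformAlgebra.prec (𝕜 := 𝕜) a b ∈ homogeneous 𝕜 X (m + n) := by
  suffices h : homogeneous 𝕜 X m ≤ (homogeneous 𝕜 X (m + n)).comap
      ((precU 𝕜).flip (incl 𝕜 b)) from h ha
  rw [homogeneous, Finsupp.supported_eq_span_single, Submodule.span_le]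
  rintro _ ⟨⟨l, x, r⟩, rfl, rfl⟩
  rw [SetLike.mem_coe, Submodule.mem_comap, LinearMap.flip_apply, precU_single]
  have h1 := star_mem_supported 𝕜 (Finsupp.single_mem_supported 𝕜 1
    (show r ∈ {s : DendTree X | s.size = r.size} from rfl)) (incl_mem_supported 𝕜 hb)
  have := Submodule.mem_map_of_mem (f := graftRight 𝕜 l x) h1
  rw [graftRight, Finsupp.lmapDomain_supported] at this
  refine Finsupp.supported_mono ?_ this
  rintro _ ⟨u, hu, rfl⟩
  simp only [Set.mem_ofPred_eq] at hu ⊢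
  omega

theorem succ_mem_homogeneous {m n : ℕ} {a b : FreeDend 𝕜 X} (ha : a ∈ homogeneous 𝕜 X m)
    (hb : b ∈ homogeneous 𝕜 X n) :
    DendriformAlgebra.succ (𝕜 := 𝕜) a b ∈ homogeneous 𝕜 X (m + n) := by
  suffices h : homogeneous 𝕜 X n ≤ (homogeneous 𝕜 X (m + n)).comap (succU 𝕜 (incl 𝕜 a)) from h hb
  rw [homogeneous, Finsupp.supported_eq_span_single, Submodule.span_le]
  rintro _ ⟨⟨l, x, r⟩, rfl, rfl⟩
  rw [SetLike.mem_coe, Submodule.mem_comap, succU_single]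
  have h1 := star_mem_supported 𝕜 (incl_mem_supported 𝕜 ha) (Finsupp.single_mem_supported 𝕜 1
    (show l ∈ {s : DendTree X | s.size = l.size} from rfl))
  have := Submodule.mem_map_of_mem (f := graftLeft 𝕜 x r) h1
  rw [graftLeft, Finsupp.lmapDomain_supported] at this
  refine Finsupp.supported_mono ?_ this
  rintro _ ⟨u, hu, rfl⟩
  simp only [Set.mem_ofPred_eq] at hu ⊢
  omega

theorem gen_mem_homogeneous (x : X) : gen 𝕜 x ∈ homogeneous 𝕜 X 1 :=
  Finsupp.single_mem_supported 𝕜 _ rfl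

end FreeDend

namespace Dend

open freeBinary

variable (𝕜 : Type u) [Field 𝕜]

/-- The value of an operation of `Dend` at the generator of the free dendriform algebra on one
generator. -/
noncomputable def evalGen (n : ℕ) : (Dend 𝕜).obj n →ₗ[𝕜] FreeDend 𝕜 Unit :=
  eval n fun _ => FreeDend.gen 𝕜 ()

theorem evalGen_comp {k r : ℕ} (n : Fin k → ℕ) (h : ∑ i, n i = r) (p : (Dend 𝕜).obj k)
    (q : ∀ i, (Dend 𝕜).obj (n i)) :
    evalGen 𝕜 r ((Dend 𝕜).comp n h p q) =
      eval k (extendZero fun i => evalGen 𝕜 (n i) (q i)) p :=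
  eval_comp n h p q _

/-- The total algebra of `Dend` is itself dendriform, so the generator can be sent to the class of
the trivial tree. The resulting morphism recovers an operation from its value at the generator. -/
theorem lift_eval (t : BinTree DendGen) :
    FreeDend.lift 𝕜 (fun _ => cls (ideal 𝕜) .leaf)
      (t.eval (ops 𝕜 (FreeDend 𝕜 Unit)) fun _ => FreeDend.gen 𝕜 ()) = cls (ideal 𝕜) t := by
  induction t with
  | leaf => exact FreeDend.lift_gen 𝕜 _ _
  | node e l r hl hr =>
    rw [← opQuot_cls, ← hl, ← hr]
    cases e with
    | prec => exact FreeDend.lift_prec 𝕜 _ _ _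
    | succ => exact FreeDend.lift_succ 𝕜 _ _ _

/-- An operation of `Dend` is determined by its value at the generator. -/
theorem evalGen_injective (n : ℕ) : Function.Injective (evalGen 𝕜 n) := by
  rw [injective_iff_map_eq_zero]
  intro p hp
  obtain ⟨p, rfl⟩ := mk_surjective n p
  have h : FreeDend.lift 𝕜 (fun _ => cls (ideal 𝕜) .leaf) ∘ₗ
      freeBinary.eval (ops 𝕜 (FreeDend 𝕜 Unit)) n (fun _ => FreeDend.gen 𝕜 ()) =
      (total (ideal 𝕜)).mkQ ∘ₗ incl 𝕜 n := by
    refine linearMap_ext fun t => ?_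
    rw [LinearMap.comp_apply, eval_mono, lift_eval, LinearMap.comp_apply, incl_mono]
    rfl
  have h1 := LinearMap.congr_fun h p
  rw [LinearMap.comp_apply, ← eval_mk, ← evalGen, hp, map_zero] at h1
  exact (Submodule.Quotient.mk_eq_zero _).2
    ((incl_mem_total _ p).1 ((Submodule.Quotient.mk_eq_zero _).1 h1.symm))

theorem eval_gen_mem_homogeneous (t : BinTree DendGen) :
    t.eval (ops 𝕜 (FreeDend 𝕜 Unit)) (fun _ => FreeDend.gen 𝕜 ()) ∈
      FreeDend.homogeneous 𝕜 Unit t.leaves := by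
  induction t with
  | leaf => exact FreeDend.gen_mem_homogeneous 𝕜 ()
  | node e l r hl hr =>
    cases e with
    | prec => exact FreeDend.prec_mem_homogeneous 𝕜 hl hr
    | succ => exact FreeDend.succ_mem_homogeneous 𝕜 hl hr

theorem evalGen_mem_homogeneous {n : ℕ} (p : (Dend 𝕜).obj n) :
    evalGen 𝕜 n p ∈ FreeDend.homogeneous 𝕜 Unit n := by
  obtain ⟨p, rfl⟩ := mk_surjective n p
  have h : (FreeDend.homogeneous 𝕜 Unit n).mkQ ∘ₗ
      freeBinary.eval (ops 𝕜 (FreeDend 𝕜 Unit)) n (fun _ => FreeDend.gen 𝕜 ()) = 0 := by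
    refine linearMap_ext fun t => ?_
    rw [LinearMap.comp_apply, eval_mono]
    have := eval_gen_mem_homogeneous 𝕜 t.1
    rw [t.2] at this
    exact (Submodule.Quotient.mk_eq_zero _).2 this
  exact (Submodule.Quotient.mk_eq_zero _).1 (LinearMap.congr_fun h p)

/-- Since (l, x, r) = l ≻ (x ≺ r), a dendriform monomial with this value is read off recursively,
with empty subtrees omitted. Each vertex contributes one leaf of the monomial. -/
theorem exists_tree_eval_eq (t : DendTree Unit) : ∀ l x r, t = .node l x r →
    ∃ s : BinTree DendGen, s.leaves = l.size + r.size + 1 ∧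
      s.eval (ops 𝕜 (FreeDend 𝕜 Unit)) (fun _ => FreeDend.gen 𝕜 ()) = Finsupp.single (l, x, r) 1 := by
  induction t with
  | nil => intro l x r h; cases h
  | node l x r ihl ihr =>
    rintro _ _ _ ⟨⟩
    obtain ⟨s, hs, hs'⟩ : ∃ s : BinTree DendGen, s.leaves = r.size + 1 ∧
        s.eval (ops 𝕜 (FreeDend 𝕜 Unit)) (fun _ => FreeDend.gen 𝕜 ()) =
          FreeDend.precU 𝕜 (FreeDend.gen 𝕜 x) (Finsupp.single r 1) := by
      cases r with
      | nil => exact ⟨.leaf, rfl, (FreeDend.precU_nil 𝕜 _).symm⟩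
      | node a y b =>
        obtain ⟨s, hs, hs'⟩ := ihr _ _ _ rfl
        refine ⟨.node .prec .leaf s, ?_, ?_⟩
        · simp only [BinTree.leaves, hs, DendTree.size]
          omega
        · rw [← FreeDend.incl_single, ← FreeDend.prec_def, ← hs']
          rfl
    rw [FreeDend.single_eq_succU_precU, ← hs']
    cases l with
    | nil => exact ⟨s, by simp [hs, DendTree.size], (FreeDend.succU_nil 𝕜 _).symm⟩
    | node a y b =>
      obtain ⟨s', h1, h2⟩ := ihl _ _ _ rfl
      refine ⟨.node .succ s' s, ?_, ?_⟩
      · simp only [BinTree.leaves, hs, h1, DendTree.size]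
        omega
      · rw [← FreeDend.incl_single, ← FreeDend.succ_def, ← h2]
        rfl

theorem exists_evalGen_eq {n : ℕ} (l : DendTree Unit) (x : Unit) (r : DendTree Unit)
    (h : l.size + r.size + 1 = n) :
    ∃ p : (Dend 𝕜).obj n, evalGen 𝕜 n p = Finsupp.single (l, x, r) 1 := by
  subst h
  obtain ⟨s, hs, hs'⟩ := exists_tree_eval_eq 𝕜 _ l x r rfl
  refine ⟨(mk 𝕜).toFun _ (mono 𝕜 (ofTree s hs)), ?_⟩
  rw [evalGen, eval_mk, eval_mono]
  exact hs'

end Dend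

/-! ### The morphism from the associative operad -/

namespace DendriformAlgebra

variable (𝕜 : Type u) [Field 𝕜] {D : Type v} [AddCommGroup D] [Module 𝕜 D] [DendriformAlgebra 𝕜 D]

/-- The product `a 0 ⋆ a 1 ⋆ … ⋆ a n`. -/
noncomputable def starProd (a : ℕ → D) : ℕ → D
  | 0 => a 0
  | n + 1 => star 𝕜 (starProd a n) (a (n + 1))

theorem starProd_congr {a b : ℕ → D} (n : ℕ) (h : ∀ i ≤ n, a i = b i) :
    starProd 𝕜 a n = starProd 𝕜 b n := by
  induction n with
  | zero => exact h 0 le_rfl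
  | succ n ih => rw [starProd, starProd, ih fun i hi => h i (by omega), h _ le_rfl]

theorem star_starProd (a : ℕ → D) (m n : ℕ) :
    star 𝕜 (starProd 𝕜 a m) (starProd 𝕜 (fun i => a (m + 1 + i)) n) =
      starProd 𝕜 a (m + n + 1) := by
  induction n with
  | zero => rfl
  | succ n ih => rw [starProd, ← star_assoc, ih, ← add_assoc, starProd]; congr 2; omega

/-- By associativity the bracketing does not matter. `starProd` at index n has n + 1 factors. -/
theorem eval_star (t : BinTree Unit) (a : ℕ → D) :
    t.eval (fun _ => star 𝕜) a = starProd 𝕜 a (t.leaves - 1) := by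
  induction t generalizing a with
  | leaf => rfl
  | node e l r hl hr =>
    have h1 := l.leaves_pos
    have h2 := r.leaves_pos
    obtain ⟨k, hk⟩ : ∃ k, l.leaves = k + 1 := ⟨l.leaves - 1, by omega⟩
    rw [BinTree.eval, hl, hr, hk, Nat.add_sub_cancel, star_starProd, BinTree.leaves]
    congr 1
    omega

end DendriformAlgebra

namespace freeBinary

variable {𝕜 : Type u} [Field 𝕜] {E : Type} {D : Type v} [AddCommGroup D] [Module 𝕜 D]
  (m : E → D →ₗ[𝕜] D →ₗ[𝕜] D)

theorem eval_gen (e : E) (a : ℕ → D) : eval m 2 a (gen 𝕜 e) = m e (a 0) (a 1) :=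
  eval_mono m a (ofTree _ (leaves_gen e))

theorem eval_compPair {k l : ℕ} (e : E) (x : (freeBinary 𝕜 E).obj k) (y : (freeBinary 𝕜 E).obj l)
    (a : ℕ → D) :
    eval m (k + l) a ((freeBinary 𝕜 E).compPair (gen 𝕜 e) x y) =
      m e (eval m k a x) (eval m l (fun j => a (k + j)) y) := by
  rw [NSOperad.compPair, eval_comp, eval_gen]
  refine congrArg₂ (fun u v => m e u v)
    (congrArg (fun b => eval m k b x) (funext fun j => ?_))
    (congrArg (fun b => eval m l b y) (funext fun j => ?_))
  · simp
  · simp [extendZero]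

end freeBinary

/-! ### Iterated star products and the morphism `starHom` -/

namespace Dend

open freeBinary DendriformAlgebra

variable (𝕜 : Type u) [Field 𝕜]

/-- The iterated star product as an operation of the free operad. -/
noncomputable def freeStarComb : ∀ n, (freeBinary 𝕜 DendGen).obj n
  | 0 => 0
  | 1 => mono 𝕜 .leaf
  | n + 2 => (freeBinary 𝕜 DendGen).compPair (gen 𝕜 .prec) (freeStarComb (n + 1)) (mono 𝕜 .leaf) +
      (freeBinary 𝕜 DendGen).compPair (gen 𝕜 .succ) (freeStarComb (n + 1)) (mono 𝕜 .leaf)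

/-- The iterated star product as an operation of `Dend`. -/
noncomputable def starComb (n : ℕ) : (Dend 𝕜).obj n := (mk 𝕜).toFun n (freeStarComb 𝕜 n)

theorem eval_starComb {D : Type v} [AddCommGroup D] [Module 𝕜 D] [DendriformAlgebra 𝕜 D]
    (a : ℕ → D) {n : ℕ} (hn : 0 < n) : eval n a (starComb 𝕜 n) = starProd 𝕜 a (n - 1) := by
  rw [starComb, eval_mk]
  obtain ⟨n, rfl⟩ : ∃ m, n = m + 1 := ⟨n - 1, by omega⟩
  induction n with
  | zero => exact eval_mono _ _ _
  | succ n ih =>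
    rw [freeStarComb, map_add, eval_compPair, eval_compPair, ih (by omega), eval_mono]
    rfl

/-- The iterated star products are closed under composition. -/
theorem comp_starComb {k r : ℕ} (n : Fin k → ℕ) (h : ∑ i, n i = r) (t : BinTree.OfArity Unit k)
    (s : ∀ i, BinTree.OfArity Unit (n i)) :
    (Dend 𝕜).comp n h (starComb 𝕜 k) (fun i => starComb 𝕜 (n i)) = starComb 𝕜 r := by
  refine evalGen_injective 𝕜 r ?_
  -- The trees `t` and `s i` certify that the arities are positive; in arity zero `freeStarComb` is
  -- only a default value.
  have hpos : ∀ {m : ℕ} (t : BinTree.OfArity Unit m), 0 < m := fun t =>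
    t.1.leaves_pos.trans_eq t.2
  have key : ∀ {m : ℕ} (t : BinTree.OfArity Unit m) (a : ℕ → FreeDend 𝕜 Unit),
      eval m a (starComb 𝕜 m) = t.1.eval (fun _ => DendriformAlgebra.star 𝕜) a := by
    intro m t a
    rw [eval_starComb 𝕜 a (hpos t), eval_star, t.2]
  -- Both sides are now values of trees under ⋆, so closure under composition becomes compatibility
  -- of evaluation with grafting.
  have h1 := BinTree.eval_graft (fun _ => DendriformAlgebra.star 𝕜) t.1
    (BinTree.extend fun i => (s i).1) fun _ => FreeDend.gen 𝕜 ()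
  rw [evalGen_comp, evalGen, key t, key (BinTree.OfArity.graft n h t s)]
  refine Eq.trans (BinTree.eval_congr _ t.1 fun i hi => ?_) h1.symm
  rw [t.2] at hi
  lift i to Fin k using hi
  rw [extendZero_val, BinTree.extend_val, evalGen, key (s i)]

/-- The morphism from the free operad on one binary operation that sends the generator to the star
product. -/
noncomputable def freeStarHom : NSOperad.Hom (freeBinary 𝕜 Unit) (Dend 𝕜) where
  toFun n := linearLift 𝕜 fun _ => starComb 𝕜 n
  map_one := linearLift_mono 𝕜 _ _
  map_comp {k r} n h p q := by
    -- Both sides are linear in `p` and multilinear in `q`, so trees suffice, and there the claim is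
    -- `comp_starComb`.
    suffices H : ∀ t : BinTree.OfArity Unit k,
        (linearLift 𝕜 fun _ => starComb 𝕜 r).compMultilinearMap
          ((freeBinary 𝕜 Unit).comp n h (mono 𝕜 t)) =
        ((Dend 𝕜).comp n h (starComb 𝕜 k)).compLinearMap
          fun i => linearLift 𝕜 fun _ => starComb 𝕜 (n i) by
      let L : (freeBinary 𝕜 Unit).obj k →ₗ[𝕜] (Dend 𝕜).obj r :=
        { toFun := fun p => linearLift 𝕜 (fun _ => starComb 𝕜 r) ((freeBinary 𝕜 Unit).comp n h p q)
          map_add' := fun p p' => by simp only [map_add, _root_.add_apply]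
          map_smul' := fun c p => by simp only [map_smul, _root_.smul_apply, RingHom.id_apply] }
      let L' : (freeBinary 𝕜 Unit).obj k →ₗ[𝕜] (Dend 𝕜).obj r :=
        { toFun := fun p => (Dend 𝕜).comp n h (linearLift 𝕜 (fun _ => starComb 𝕜 k) p)
            fun i => linearLift 𝕜 (fun _ => starComb 𝕜 (n i)) (q i)
          map_add' := fun p p' => by simp only [map_add, _root_.add_apply]
          map_smul' := fun c p => by simp only [map_smul, _root_.smul_apply, RingHom.id_apply] }
      suffices hL : L = L' from LinearMap.congr_fun hL p
      refine linearMap_ext fun t => ?_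
      refine (DFunLike.congr_fun (H t) q).trans ?_
      simp only [L', LinearMap.coe_mk, AddHom.coe_mk, linearLift_mono]
      rfl
    intro t
    refine multilinearMap_ext fun s => ?_
    simp only [LinearMap.compMultilinearMap_apply, MultilinearMap.compLinearMap_apply, comp_mono,
      linearLift_mono]
    exact (comp_starComb 𝕜 n h t s).symm

/-- The morphism from the associative operad that sends the product to the star product. -/
noncomputable def starHom : NSOperad.Hom (As 𝕜) (Dend 𝕜) :=
  (freeStarHom 𝕜).liftQuotient _ <| NSOperad.OpIdeal.span_le _ fun n x hx => by
    cases hx with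
    | assoc =>
      -- The image of a tree depends only on its number of leaves, so the two sides of the
      -- associativity relation have the same image.
      refine LinearMap.mem_ker.2 ?_
      rw [map_sub, sub_eq_zero]
      exact (linearLift_mono 𝕜 (fun _ => starComb 𝕜 3) (ofTree _ (leaves_left () ()))).trans
        (linearLift_mono 𝕜 (fun _ => starComb 𝕜 3) (ofTree _ (leaves_right () ()))).symm

theorem starHom_mul : (starHom 𝕜).toFun 2 (As.mul 𝕜) = Dend.prec 𝕜 + Dend.succ 𝕜 := by
  have h1 : (starHom 𝕜).toFun 2 (As.mul 𝕜) = starComb 𝕜 2 :=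
    linearLift_mono 𝕜 _ (ofTree _ (leaves_gen ()))
  refine evalGen_injective 𝕜 2 ?_
  rw [h1, evalGen, eval_starComb 𝕜 _ (by norm_num), map_add]
  have h2 : ∀ e, eval 2 (fun _ => FreeDend.gen 𝕜 ()) ((mk 𝕜).toFun 2 (gen 𝕜 e)) =
      ops 𝕜 (FreeDend 𝕜 Unit) e (FreeDend.gen 𝕜 ()) (FreeDend.gen 𝕜 ()) := fun e =>
    eval_gen _ e _
  exact (congrArg₂ (· + ·) (h2 .prec) (h2 .succ)).symm

end Dend

/-- The composition of morphisms of operads. -/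
def NSOperad.Hom.comp {𝕜 : Type u} [Field 𝕜] {P Q R : NSOperad.{u, u} 𝕜} (ψ : Hom Q R)
    (φ : Hom P Q) : Hom P R where
  toFun n := ψ.toFun n ∘ₗ φ.toFun n
  map_one := by rw [LinearMap.comp_apply, φ.map_one, ψ.map_one]
  map_comp n h p q := by simp only [LinearMap.comp_apply, φ.map_comp, ψ.map_comp]

theorem As.hom_ext {𝕜 : Type u} [Field 𝕜] {Q : NSOperad.{u, u} 𝕜} {φ ψ : NSOperad.Hom (As 𝕜) Q}
    (h : φ.toFun 2 (As.mul 𝕜) = ψ.toFun 2 (As.mul 𝕜)) : φ = ψ := by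
  refine NSOperad.Hom.ext (funext fun n => Submodule.linearMap_qext _ ?_)
  exact freeBinary.hom_apply_eq
    (φ := φ.comp ((freeBinary 𝕜 Unit).quotientHom (As.ideal 𝕜)))
    (ψ := ψ.comp ((freeBinary 𝕜 Unit).quotientHom (As.ideal 𝕜))) (fun _ => h) n

/-! ### Freeness of the dendriform operad over the associative operad -/

namespace DendTree

/-- The tree whose components are `b 0, …, b (n - 1)`. -/
def ofComponents (b : ℕ → DendTree Unit) : ℕ → DendTree Unit
  | 0 => nil
  | n + 1 => node (ofComponents b n) () (b n)

/-- The right subtrees along the leftmost branch of a tree, from the leaf to the root. -/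
def components : DendTree Unit → List (DendTree Unit)
  | nil => []
  | node l _ r => components l ++ [r]

theorem components_injective : Function.Injective components := by
  intro s
  induction s with
  | nil => intro t h; cases t <;> simp_all [components]
  | node l x r ihl _ =>
    intro t h
    cases t with
    | nil => simp [components] at h
    | node l' x' r' =>
      obtain ⟨h1, h2⟩ := List.append_inj' h rfl
      rw [ihl h1, List.singleton_injective h2]

theorem components_ofComponents (b : ℕ → DendTree Unit) (n : ℕ) :
    components (ofComponents b n) = List.ofFn fun i : Fin n => b i := by
  induction n with
  | zero => rfl
  | succ n ih => rw [ofComponents, components, ih, List.ofFn_succ_last]; simp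

/-- Each component consists of a vertex of the leftmost branch together with its right subtree,
hence the `+ 1`. The sizes of the components thus form a composition of the size of the tree. -/
theorem sum_components (t : DendTree Unit) :
    ((components t).map fun s => s.size + 1).sum = t.size := by
  induction t with
  | nil => rfl
  | node l x r ihl _ => simp [components, ihl, size, add_assoc]

variable (𝕜 : Type u) [Field 𝕜]

/-- Links the operadic side with the triangular basis. `starProd` at index `n` multiplies `n + 1`
factors, so the tree has `n + 1` components. -/
theorem incl_starProd (b : ℕ → DendTree Unit) (n : ℕ) :
    FreeDend.incl 𝕜 (DendriformAlgebra.starProd 𝕜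
      (fun i => (Finsupp.single (nil, (), b i) 1 : FreeDend 𝕜 Unit)) n) =
        combProd 𝕜 (ofComponents b (n + 1)) := by
  induction n with
  | zero => simp [DendriformAlgebra.starProd, ofComponents, combProd, nil_star]
  | succ n ih =>
    rw [DendriformAlgebra.starProd, FreeDend.incl_star, ih, FreeDend.incl_single]
    rfl

/-- The families of components of the trees with `r` internal vertices. -/
abbrev ComponentFamily (r : ℕ) : Type :=
  (c : Composition r) × ∀ i : Fin c.length, {s : DendTree Unit // s.size + 1 = c.blocksFun i}

/-- The extension of a finite sequence of trees by empty trees. -/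
def extendNil {k : ℕ} (b : Fin k → DendTree Unit) (i : ℕ) : DendTree Unit :=
  if h : i < k then b ⟨i, h⟩ else nil

theorem extendNil_val {k : ℕ} (b : Fin k → DendTree Unit) (i : Fin k) : extendNil b i = b i := by
  simp [extendNil]

/-- The tree with a given family of components. -/
def ofFamily {r : ℕ} (z : ComponentFamily r) : DendTree Unit :=
  ofComponents (extendNil fun i => (z.2 i).1) z.1.length

theorem components_ofFamily {r : ℕ} (z : ComponentFamily r) :
    components (ofFamily z) = List.ofFn fun i => (z.2 i).1 := by
  simp only [ofFamily, components_ofComponents, extendNil_val]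

theorem map_components_ofFamily {r : ℕ} (z : ComponentFamily r) :
    (components (ofFamily z)).map (fun s => s.size + 1) = z.1.blocks := by
  rw [components_ofFamily, List.map_ofFn, ← z.1.ofFn_blocksFun]
  congr 1
  funext i
  exact (z.2 i).2

/-- The sequence of components determines the family: their sizes give the composition, their right
subtrees the entries. -/
theorem ofFamily_injective (r : ℕ) : Function.Injective (ofFamily (r := r)) := by
  rintro ⟨c, s⟩ ⟨c', s'⟩ h
  obtain rfl : c = c' := Composition.ext <| by
    have h1 := map_components_ofFamily ⟨c, s⟩
    rw [h, map_components_ofFamily] at h1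
    exact h1.symm
  have h1 := components_ofFamily ⟨c, s⟩
  rw [h, components_ofFamily] at h1
  have h2 := List.ofFn_injective h1
  congr 1
  funext i
  exact Subtype.ext (congrFun h2 i).symm

theorem exists_ofFamily_eq (t : DendTree Unit) : ∃ z : ComponentFamily t.size, ofFamily z = t := by
  let c : Composition t.size :=
    ⟨(components t).map fun s => s.size + 1, by simp, sum_components t⟩
  have hc : c.length = (components t).length := List.length_map _
  refine ⟨⟨c, fun i => ⟨(components t).get (i.cast hc), ?_⟩⟩, components_injective ?_⟩
  · simp [Composition.blocksFun, c]
  · rw [components_ofFamily]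
    refine List.ext_getElem (by simp [hc]) fun i h1 h2 => ?_
    simp

end DendTree

namespace As

variable (𝕜 : Type u) [Field 𝕜]

/-- The projection of the free operad onto `As`. -/
noncomputable def mk : NSOperad.Hom (freeBinary 𝕜 Unit) (As 𝕜) :=
  (freeBinary 𝕜 Unit).quotientHom _

theorem mk_surjective (n : ℕ) : Function.Surjective ((mk 𝕜).toFun n) :=
  Submodule.mkQ_surjective _

/-- The class of a tree in `As`. -/
noncomputable def ofTree {n : ℕ} (t : BinTree.OfArity Unit n) : (As 𝕜).obj n :=
  (mk 𝕜).toFun n (freeBinary.mono 𝕜 t)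

variable {𝕜}

/-- All trees with `n` leaves have the same class. Only this spanning statement is needed: linear
independence in As ∘ K will come from the images in `Dend`. -/
theorem exists_eq_smul {n : ℕ} (t : BinTree.OfArity Unit n) (p : (As 𝕜).obj n) :
    ∃ c : 𝕜, p = c • ofTree 𝕜 t := by
  obtain ⟨p, rfl⟩ := mk_surjective 𝕜 n p
  have h : (𝕜 ∙ ofTree 𝕜 t).mkQ ∘ₗ (mk 𝕜).toFun n = 0 := by
    refine freeBinary.linearMap_ext fun s => (Submodule.Quotient.mk_eq_zero _).2 ?_
    have h1 : (mk 𝕜).toFun n (freeBinary.mono 𝕜 s) = ofTree 𝕜 t :=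
      (Submodule.Quotient.eq _).2 (As.mono_sub_mono_mem 𝕜 s t)
    rw [h1]
    exact Submodule.mem_span_singleton_self _
  have h2 := (Submodule.Quotient.mk_eq_zero _).1 (LinearMap.congr_fun h p)
  obtain ⟨c, hc⟩ := Submodule.mem_span_singleton.1 h2
  exact ⟨c, hc.symm⟩

end As

theorem BinTree.exists_leaves_eq (n : ℕ) : ∃ t : BinTree Unit, t.leaves = n + 1 := by
  induction n with
  | zero => exact ⟨.leaf, rfl⟩
  | succ n ih =>
    obtain ⟨t, ht⟩ := ih
    exact ⟨.node () t .leaf, by rw [BinTree.leaves, ht]; rfl⟩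

/-! ### The generating collection and the bijectivity of the induced map -/

namespace Dend

open DendTree

variable (𝕜 : Type u) [Field 𝕜]

/-- The collection with a basis given by the trees with empty left subtree. -/
noncomputable def generators : NSCollection.{u, u} 𝕜 where
  obj n := {s : DendTree Unit // s.size + 1 = n} →₀ 𝕜
  subsingleton_zero := by
    have : IsEmpty {s : DendTree Unit // s.size + 1 = 0} := ⟨fun s => by simpa using s.2⟩
    infer_instance

/-- The operation of `Dend` that corresponds to the tree with empty left subtree and right subtree
`s`. -/
noncomputable def genOp {n : ℕ} (s : {s : DendTree Unit // s.size + 1 = n}) : (Dend 𝕜).obj n :=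
  (exists_evalGen_eq 𝕜 nil () s.1 (by simpa [size] using s.2)).choose

theorem evalGen_genOp {n : ℕ} (s : {s : DendTree Unit // s.size + 1 = n}) :
    evalGen 𝕜 n (genOp 𝕜 s) = Finsupp.single (nil, (), s.1) 1 :=
  (exists_evalGen_eq 𝕜 nil () s.1 (by simpa [size] using s.2)).choose_spec

/-- A basis element of the collection of generators. -/
noncomputable def genBasis {n : ℕ} (s : {s : DendTree Unit // s.size + 1 = n}) :
    (generators 𝕜).obj n :=
  Finsupp.single s (1 : 𝕜)

theorem generators_multilinearMap_ext {k : ℕ} {n : Fin k → ℕ} {M : Type w} [AddCommGroup M]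
    [Module 𝕜 M] {f g : MultilinearMap 𝕜 (fun i => (generators 𝕜).obj (n i)) M}
    (h : ∀ s : ∀ i, {s : DendTree Unit // s.size + 1 = n i},
      f (fun i => genBasis 𝕜 (s i)) = g (fun i => genBasis 𝕜 (s i))) : f = g := by
  refine Module.Basis.ext_multilinear (fun i => (Finsupp.basisSingleOne :
    Module.Basis _ 𝕜 ({s : DendTree Unit // s.size + 1 = n i} →₀ 𝕜))) fun s => ?_
  have h1 : (fun i => (Finsupp.basisSingleOne :
      Module.Basis _ 𝕜 ({s : DendTree Unit // s.size + 1 = n i} →₀ 𝕜)) (s i)) =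
        fun i => Finsupp.single (s i) 1 := by
    simp only [Finsupp.coe_basisSingleOne]
  exact (congrArg f h1).trans ((h s).trans (congrArg g h1).symm)

/-- The inclusion of the generators. -/
noncomputable def generatorsHom :
    NSCollection.Hom (generators 𝕜) (starHom 𝕜).leftModule.toNSCollection where
  toFun _ := Finsupp.linearCombination 𝕜 (genOp 𝕜)

theorem generatorsHom_genBasis {n : ℕ} (s : {s : DendTree Unit // s.size + 1 = n}) :
    (generatorsHom 𝕜).toFun n (genBasis 𝕜 s) = genOp 𝕜 s :=
  (Finsupp.linearCombination_single 𝕜 1 s).trans (one_smul 𝕜 _)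

variable {r : ℕ} (T : ∀ c : Composition r, BinTree.OfArity Unit c.length)

/-- The element of `As ∘ K` given by a family of generators. -/
noncomputable def familyElement (z : ComponentFamily r) :
    ((As 𝕜).toNSCollection.circ (generators 𝕜)).obj r :=
  DirectSum.lof 𝕜 (Composition r) (fun c : Composition r =>
    (As 𝕜).obj c.length ⊗[𝕜] (⨂[𝕜] i : Fin c.length, (generators 𝕜).obj (c.blocksFun i))) z.1
    (As.ofTree 𝕜 (T z.1) ⊗ₜ
      PiTensorProduct.tprod 𝕜 fun i => genBasis 𝕜 (z.2 i))

theorem inducedHom_familyElement (z : ComponentFamily r) :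
    ((starHom 𝕜).leftModule.inducedHom (generators 𝕜) (generatorsHom 𝕜)).toFun r
      (familyElement 𝕜 T z) =
    (Dend 𝕜).comp z.1.blocksFun z.1.sum_blocksFun (starComb 𝕜 z.1.length)
      fun i => genOp 𝕜 (z.2 i) := by
  refine (DirectSum.toModule_lof 𝕜 z.1 _).trans ?_
  refine (TensorProduct.lift.tmul _ _).trans ?_
  refine (PiTensorProduct.lift.tprod _).trans ?_
  refine (MultilinearMap.compLinearMap_apply _ _ _).trans ?_
  simp only [generatorsHom_genBasis]
  refine DFunLike.congr_fun (congrArg ((Dend 𝕜).comp z.1.blocksFun z.1.sum_blocksFun) ?_) _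
  exact freeBinary.linearLift_mono 𝕜 (fun _ => starComb 𝕜 _) (T z.1)

/-- The heart of the operadic statement: a spanning element of As ∘ K is sent to the product of its
components, which is the triangular basis vector of the tree that they form. -/
theorem incl_evalGen_inducedHom (hr : 0 < r) (z : ComponentFamily r) :
    FreeDend.incl 𝕜 (evalGen 𝕜 r
      (((starHom 𝕜).leftModule.inducedHom (generators 𝕜) (generatorsHom 𝕜)).toFun r
        (familyElement 𝕜 T z))) = combProd 𝕜 (ofFamily z) := by
  have hlen := z.1.length_pos_iff.2 hr
  rw [inducedHom_familyElement, evalGen_comp, eval_starComb 𝕜 _ hlen]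
  simp only [evalGen_genOp]
  have h1 : DendriformAlgebra.starProd 𝕜
      (extendZero fun i => (Finsupp.single (nil, (), (z.2 i).1) 1 : FreeDend 𝕜 Unit))
        (z.1.length - 1) = DendriformAlgebra.starProd 𝕜
      (fun i => (Finsupp.single (nil, (), extendNil (fun i => (z.2 i).1) i) 1 : FreeDend 𝕜 Unit))
        (z.1.length - 1) := by
    refine DendriformAlgebra.starProd_congr 𝕜 _ fun i hi => ?_
    have hi' : i < z.1.length := by omega
    lift i to Fin z.1.length using hi'
    rw [extendZero_val, extendNil_val]
  rw [h1, incl_starProd, Nat.sub_add_cancel hlen, ofFamily]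

/-- Each summand of As ∘ K is spanned by pure tensors of basis elements, and its factor from `As` is
spanned by the class of the chosen tree `T c`. -/
theorem span_familyElement : Submodule.span 𝕜 (Set.range (familyElement 𝕜 T)) = ⊤ := by
  set N := Submodule.span 𝕜 (Set.range (familyElement 𝕜 T))
  suffices h : N.mkQ = 0 by
    rw [← Submodule.ker_mkQ N, h, LinearMap.ker_zero]
  refine DirectSum.linearMap_ext 𝕜 fun c => TensorProduct.ext' fun p x => ?_
  obtain ⟨a, rfl⟩ := As.exists_eq_smul (T c) p
  rw [← TensorProduct.smul_tmul', map_smul, map_smul]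
  congr 1
  suffices h : (N.mkQ ∘ₗ DirectSum.lof 𝕜 (Composition r) (fun c : Composition r =>
      (As 𝕜).obj c.length ⊗[𝕜] (⨂[𝕜] i : Fin c.length, (generators 𝕜).obj (c.blocksFun i))) c) ∘ₗ
      TensorProduct.mk 𝕜 _ _ (As.ofTree 𝕜 (T c)) = 0 from LinearMap.congr_fun h x
  refine PiTensorProduct.ext (generators_multilinearMap_ext 𝕜 fun s => ?_)
  exact (Submodule.Quotient.mk_eq_zero _).2 (Submodule.subset_span ⟨⟨c, s⟩, rfl⟩)

/-- The dendriform operad is a free left module over the associative operad. -/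
theorem isFree_leftModule_starHom : (starHom 𝕜).leftModule.IsFree := by
  refine ⟨generators 𝕜, generatorsHom 𝕜, fun r => ?_⟩
  rcases Nat.eq_zero_or_pos r with rfl | hr
  -- In arity zero both sides vanish. The case is separate because the composition of zero has
  -- length zero and no tree has zero leaves.
  · have h1 := ((As 𝕜).toNSCollection.circ (generators 𝕜)).subsingleton_zero
    have h2 := (Dend 𝕜).subsingleton_zero
    exact ⟨fun _ _ _ => Subsingleton.elim _ _,
      fun y => ⟨0, Subsingleton.elim (α := (Dend 𝕜).obj 0) _ _⟩⟩
  have hT : ∀ c : Composition r, Nonempty (BinTree.OfArity Unit c.length) := fun c => by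
    obtain ⟨t, ht⟩ := BinTree.exists_leaves_eq (c.length - 1)
    exact ⟨⟨t, ht.trans (Nat.sub_add_cancel (c.length_pos_iff.2 hr))⟩⟩
  let T : ∀ c : Composition r, BinTree.OfArity Unit c.length := fun c => (hT c).some
  set f := ((starHom 𝕜).leftModule.inducedHom (generators 𝕜) (generatorsHom 𝕜)).toFun r
  let σ := Finsupp.linearCombination 𝕜 (familyElement 𝕜 T)
  have hσ : Function.Surjective σ := by
    rw [← LinearMap.range_eq_top, Finsupp.range_linearCombination, span_familyElement]
  let e : (Dend 𝕜).obj r →ₗ[𝕜] (DendTree Unit →₀ 𝕜) := FreeDend.incl 𝕜 ∘ₗ evalGen 𝕜 r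
  have he : Function.Injective e := (FreeDend.incl_injective 𝕜).comp (evalGen_injective 𝕜 r)
  -- In coordinates, the induced map is the relabelling of families as trees followed by the
  -- triangular automorphism. Both are injective, so `f` is injective because `σ` is surjective.
  have key : ∀ v, e (f (σ v)) = combEquiv 𝕜 (Finsupp.mapDomain ofFamily v) := by
    intro v
    suffices h : e ∘ₗ f ∘ₗ σ = (combEquiv 𝕜).toLinearMap ∘ₗ Finsupp.lmapDomain 𝕜 𝕜 ofFamily from
      LinearMap.congr_fun h v
    refine Finsupp.lhom_ext' fun z => LinearMap.ext_ring ?_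
    have h1 : σ (Finsupp.single z 1) = familyElement 𝕜 T z := by simp [σ]
    have h2 : e (f (σ (Finsupp.single z 1))) = combProd 𝕜 (ofFamily z) := by
      rw [h1]
      exact incl_evalGen_inducedHom 𝕜 T hr z
    refine h2.trans ?_
    simp [combEquiv_single]
  constructor
  · intro x y hxy
    obtain ⟨v, rfl⟩ := hσ x
    obtain ⟨w, rfl⟩ := hσ y
    have h1 := (key v).symm.trans ((congrArg e hxy).trans (key w))
    rw [Finsupp.mapDomain_injective (ofFamily_injective r) ((combEquiv 𝕜).injective h1)]
  · intro y
    -- The automorphism `combEquiv` preserves size, and its restriction to trees with `r` vertices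
    -- is onto. So the preimage can be taken among combinations of such trees.
    have h1 : e y ∈ (Finsupp.supported 𝕜 𝕜 {s : DendTree Unit | s.size = r}).map
        (combEquiv 𝕜).toLinearMap := by
      have h2 := FreeDend.incl_mem_supported 𝕜 (evalGen_mem_homogeneous 𝕜 y)
      refine (?_ : Finsupp.supported 𝕜 𝕜 {s : DendTree Unit | s.size = r} ≤ _) h2
      rw [Finsupp.supported_eq_span_single, Submodule.span_le]
      rintro _ ⟨t, rfl, rfl⟩
      refine (Submodule.span_le.2 ?_ : _ ≤ _) (single_mem_span_combProd 𝕜 t)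
      rintro _ ⟨s, hs, rfl⟩
      exact ⟨Finsupp.single s 1, Submodule.subset_span ⟨s, hs, rfl⟩, combEquiv_single 𝕜 s⟩
    obtain ⟨w, hw, hwy⟩ := h1
    -- Every tree with `r` vertices comes from a family, by cutting it into its components.
    have h3 : w ∈ (Finsupp.supported 𝕜 𝕜 (Set.univ : Set (ComponentFamily r))).map
        (Finsupp.lmapDomain 𝕜 𝕜 ofFamily) := by
      rw [Finsupp.lmapDomain_supported, Set.image_univ]
      refine Finsupp.supported_mono ?_ hw
      rintro t rfl
      exact exists_ofFamily_eq t
    obtain ⟨v, -, rfl⟩ := h3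
    exact ⟨σ v, he ((key v).trans hwy)⟩

end Dend

theorem proposition5p9 {𝕜 : Type u} [Field 𝕜] [CharZero 𝕜] :
    (∃ φ : NSOperad.Hom (As 𝕜) (Dend 𝕜),
      φ.toFun 2 (As.mul 𝕜) = Dend.prec 𝕜 + Dend.succ 𝕜 ∧
      (∀ ψ : NSOperad.Hom (As 𝕜) (Dend 𝕜),
        ψ.toFun 2 (As.mul 𝕜) = Dend.prec 𝕜 + Dend.succ 𝕜 → ψ = φ) ∧
      φ.leftModule.IsFree) ∧
    ∀ (X : Type v) (D : Type (max u v)) [AddCommGroup D] [Module 𝕜 D] [DendriformAlgebra 𝕜 D]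
      (ι : X → D), DendriformAlgebra.IsFreeOn 𝕜 ι →
      ∃ Y : Set D, IsFreeAssocOn.{u, max u v, max u v, w} 𝕜
        (DendriformAlgebra.star 𝕜 (D := D)) (fun y : Y => (y : D)) :=
  ⟨⟨Dend.starHom 𝕜, Dend.starHom_mul 𝕜,
    fun _ hψ => As.hom_ext (hψ.trans (Dend.starHom_mul 𝕜).symm),
    Dend.isFree_leftModule_starHom 𝕜⟩,
  fun _ _ _ _ _ _ h => h.exists_isFreeAssocOn⟩
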